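/- **Setting.** Let $\lambda=[\lambda_1>\dots>\lambda_n\ge 1]$ be integers, $n\ge 1$. All models below consist of the orientations of the edges of a grid such that every tetravalent vertex has two incoming and two outgoing edges. Columns are numbered from right to left. All left edges of rows point inward and all bottom edges of columns point outward. The top edge of a column points outward if the column label is a part of $\lambda$, and inward otherwise. For a u-turn bend (drawn on the right, with a bivalent vertex) joining rows $j$ and $\bar j$, one of the two right edges is directed into the bend and the other out of it. * $\mathfrak B^\lambda$: rows $1,\dots,n,\bar n,\dots,\bar 1$ from top to bottom, columns $1,\dots,\lambda_1$, a bend joining $j$ and $\bar j$ for each $j$. * $\mathfrak B_*^\lambda$: as $\mathfrak B^\lambda$, with an additional central row $0$ without a bend whose right edge points outward. * $\mathfrak C^\lambda$: as $\mathfrak B^\lambda$, with a central row $0$ and a half column $0$ to the right of the full columns that meets only the rows $\bar n,\dots,\bar 1$; the right end of row $0$ is joined to the top of the half column at a bivalent corner vertex (one edge in, one edge out). * $\mathfrak C_*^\lambda$: as $\mathfrak B^\lambda$, with an additional half column $0$ on the right that meets only the rows $\bar n,\dots,\bar 1$, with top edge pointing inward. * $\mathfrak D^\lambda$: as $\mathfrak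 C_*^\lambda$, but the half column is labelled $1$, the full columns are labelled $2,\dots,\lambda_1$, and the top edge of the half column follows the general rule (outward iff $1\in\lambda$). * $\mathfrak{BC}^\lambda$: rows $1,\dots,n-1,n,\overline{n-1},\dots,\bar 1$, columns $1,\dots,\lambda_1$, bends joining $j$ and $\bar j$ for $j<n$; both ends of the central row $n$ point inward. Let $m=n-1$ for $\mathfrak{BC}$ and $m=n$ otherwise. A vertex in row $j$ has weight $a_1^{(j)},a_2^{(j)},b_1^{(j)},b_2^{(j)},c_1^{(j)},c_2^{(j)}$ if its incoming edges are NW, SE, SW, NE, NS, EW, respectively. In row $\bar j$ the weights are $a_1^{(\bar j)}=a_2^{(j)}$, $a_2^{(\bar j)}=a_1^{(j)}$, $b_1^{(\bar j)}=b_2^{(j)}$, $b_2^{(\bar j)}=b_1^{(j)}$, $c_1^{(\bar j)}=c_1^{(j)}$, $c_2^{(\bar j)}=c_2^{(j)}$. In the central row (index $0$, or $n$ for $\mathfrak{BC}$) they are $a_1=a_2=a$, $b_1=b_2=b$, $c_1$, $c_2$. A bend has weight $D^{(j)}$ if it is directed from row $j$ to row $\bar j$, and $U^{(j)}=1$ otherwise,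 where $D^{(j)}=i$ for $\mathfrak B,\mathfrak C$ and $D^{(j)}=1$ for the other models. The corner of $\mathfrak C$ has weight $1$ if row $0$ points right there, and $a^{(0)}-i\,b^{(0)}$ otherwise. $\mathcal Z(\mathfrak M^\lambda)$ is the sum over all states of the product of the weights of all vertices. The weights are free-fermionic: $a_1^{(j)}a_2^{(j)}+b_1^{(j)}b_2^{(j)}=c_1^{(j)}c_2^{(j)}$ for all $j$, and $a^2+b^2=c_1c_2$ in the central row. **Theorem.** Put $$P_m=\prod_{1\le j<k\le m}\left(a_1^{(k)}a_2^{(j)}+b_1^{(j)}b_2^{(k)}\right)\left(a_2^{(j)}a_2^{(k)}+b_1^{(k)}b_1^{(j)}\right)$$ and let $F=F(\mathfrak M^\lambda)$ be * $\mathfrak B$: $\prod_{j\le n}\left(a_2^{(j)}+i\,b_1^{(j)}\right)P_n$; * $\mathfrak B_*$: $\prod_{j\le n}\left(a^{(0)}a_2^{(j)}+b_1^{(j)}b^{(0)}\right)P_n$; * $\mathfrak C$: $\prod_{j\le n}\left(a_2^{(j)}+i\,b_1^{(j)}\right)\left(a^{(0)}a_2^{(j)}+b_1^{(j)}b^{(0)}\right)P_n$;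 * $\mathfrak C_*$: $\prod_{j\le n}\left((a_2^{(j)})^2+(b_1^{(j)})^2\right)P_n$; * $\mathfrak D$, $1\in\lambda$: $P_n$; * $\mathfrak D$, $1\notin\lambda$: $\prod_{j\le n}\left((a_2^{(j)})^2+(b_1^{(j)})^2\right)P_n$; * $\mathfrak{BC}$: $\prod_{j<n}\left(a^{(n)}a_2^{(j)}+b_1^{(j)}b^{(n)}\right)\left((a_2^{(j)})^2+(b_1^{(j)})^2\right)P_{n-1}$. Normalize all $c_2=1$, so that $c_1^{(j)}=a_1^{(j)}a_2^{(j)}+b_1^{(j)}b_2^{(j)}$ and, in the central row, $c_1=a^2+b^2$. Then, for each of the six models, $F$ divides $\mathcal Z(\mathfrak M^\lambda)$ in the polynomial ring over $\mathbb Z[i]$ in the indeterminates $a_1^{(j)},a_2^{(j)},b_1^{(j)},b_2^{(j)}$ $(1\le j\le m)$ and $a,b$ of the central row. The quotient $Q$ is a polynomial that is invariant under all permutations of the spectral indices $1,\dots,m$ and, for each $j\le m$, under the replacement of $j$ by $\bar j$ (that is, $a_1^{(j)}\leftrightarrow a_2^{(j)}$, $b_1^{(j)}\leftrightarrow b_2^{(j)}$).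 Moreover, for arbitrary free-fermionic weights in a commutative ring $R$ with a given ring homomorphism $\mathbb Z[i]\to R$, with bend and corner weights as above, and with $c_2^{(0)}=1$ in type $\mathfrak C$, the partition function equals $\prod_{j\le m}c_2^{(j)}\cdot F\cdot Q$, with an additional factor $c_2^{(n)}$ for $\mathfrak{BC}$, where $F$ and $Q$ are evaluated at the given weights. -/

import Mathlib

/-- The six families of bent ice models. -/
inductive IceModel
  | B
  | Bstar
  | C
  | Cstar
  | D
  | BC
  deriving DecidableEq

namespace IceModel

/-- The number of u-turn bends, i.e. of pairs of rows `j`, `j̄`, when the weight has `n` parts. -/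
def bends (M : IceModel) (n : ℕ) : ℕ :=
  match M with
  | BC => n - 1
  | _ => n

/-- The number of central rows without a bend (labelled `0` in types `B_*`, `C`, and `n` in
type `BC`). -/
def central : IceModel → ℕ
  | Bstar => 1
  | C => 1
  | BC => 1
  | _ => 0

/-- Whether there is a half column at the far right, meeting only the lower rows. -/
def hasHalfColumn : IceModel → Bool
  | C => true
  | Cstar => true
  | D => true
  | _ => false

/-- The number of columns, the half column included, if the greatest part is `l`.  The column in
position `p` from the left, counted from `0`, carries the label `l - p`; hence the labels are
`l, ..., 1`, or `l, ..., 1, 0` in types `C` and `C_*`, whose half column is labelled `0`.  In type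
`D` the half column is the one labelled `1`. -/
def cols (M : IceModel) (l : ℕ) : ℕ :=
  match M with
  | C => l + 1
  | Cstar => l + 1
  | _ => l

/-- The total number of rows. -/
def numRows (M : IceModel) (n : ℕ) : ℕ := 2 * M.bends n + M.central

/-- Row labels: the upper rows `j`, the central row if there is one, the lower rows `j̄`. -/
abbrev Row (M : IceModel) (n : ℕ) : Type :=
  Fin (M.bends n) ⊕ Fin M.central ⊕ Fin (M.bends n)

/-- The level of a row, counted from `0` at the top.  From top to bottom the rows are the upper
rows in increasing order, the central row, and the lower rows `j̄` in decreasing order of `j`. -/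
def level {M : IceModel} {n : ℕ} : M.Row n → Fin (M.numRows n)
  | .inl j => ⟨j, by have := j.isLt; unfold numRows; omega⟩
  | .inr (.inl c) => ⟨M.bends n + c, by have := c.isLt; unfold numRows; omega⟩
  | .inr (.inr j) => ⟨2 * M.bends n + M.central - 1 - j, by
      have := j.isLt; unfold numRows; omega⟩

/-- What sits at the place where a row meets a column. -/
inductive Cell
  /-- a tetravalent vertex -/
  | vertex
  /-- no vertex: the row passes here without meeting the half column -/
  | crossing
  /-- the bivalent vertex at which the central row of type `C` turns down into the half column -/
  | corner

/-- The half column has vertices in the lower rows only; in type `C` it starts at the corner in the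
central row.  For uniformity the half column is prolonged upwards to the top of the diagram; it
crosses the upper rows without interaction. -/
def cell (M : IceModel) {n l : ℕ} (r : M.Row n) (p : Fin (M.cols l)) : Cell :=
  if M.hasHalfColumn = true ∧ (p : ℕ) + 1 = M.cols l then
    match r with
    | .inl _ => .crossing
    | .inr (.inl _) => .corner
    | .inr (.inr _) => .vertex
  else .vertex

/-- An orientation of all edges.  In the first component, `A.1 r p` is the horizontal edge of row
`r` to the left of column position `p` (and to the right of the last column for the last index);
`true` means that it points to the right.  In the second component, `A.2 k p` is the vertical edge
in column position `p` above level `k` (and below the last row for the last index); `true` means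
that it points down. -/
abbrev Config (M : IceModel) (n l : ℕ) : Type :=
  (M.Row n → Fin (M.cols l + 1) → Bool) × (Fin (M.numRows n + 1) → Fin (M.cols l) → Bool)

section

variable {M : IceModel} {n l : ℕ}

/-- The edge to the west of the place `(r, p)`. -/
def west (A : M.Config n l) (r : M.Row n) (p : Fin (M.cols l)) : Bool := A.1 r p.castSucc
/-- The edge to the east of the place `(r, p)`. -/
def east (A : M.Config n l) (r : M.Row n) (p : Fin (M.cols l)) : Bool := A.1 r p.succ
/-- The edge to the north of the place `(r, p)`. -/
def north (A : M.Config n l) (r : M.Row n) (p : Fin (M.cols l)) : Bool := A.2 (level r).castSucc p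
/-- The edge to the south of the place `(r, p)`. -/
def south (A : M.Config n l) (r : M.Row n) (p : Fin (M.cols l)) : Bool := A.2 (level r).succ p

end

/-- The local condition at a place with the given adjacent edges.  At a tetravalent vertex the
in-degree is two.  At a crossing both lines go straight on.  At the corner the west edge continues
as the south edge; its two other edges are not part of the diagram, and the boundary conditions fix
their value. -/
def localRule : Cell → (w e nn s : Bool) → Prop
  | .vertex, w, e, nn, s => w.toNat + (!e).toNat + nn.toNat + (!s).toNat = 2
  | .crossing, w, e, nn, s => w = e ∧ nn = s
  | .corner, w, _, _, s => w = s

instance (c : Cell) (w e nn s : Bool) : Decidable (localRule c w e nn s) := by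
  cases c <;> (unfold localRule; infer_instance)

/-- The admissible states of the model attached to `lam`.  All left edges point inward, all bottom
edges point outward, the top edge of a column points outward (up) exactly if the label of the column
is a part of `lam` (the label `0` never is), each bend has one inward and one outward arrow, and the
right edge of the central row points outward in type `B_*` and inward in type `BC`.
(In type `C` the last clause only fixes the value on an edge which is not part of the diagram.) -/
def Admissible (M : IceModel) {n : ℕ} [NeZero n] (lam : Fin n → ℕ) (A : M.Config n (lam 0)) :
    Prop :=
  (∀ r, A.1 r 0 = true) ∧
  (∀ p, A.2 (Fin.last _) p = true) ∧
  (∀ p, A.2 0 p = false ↔ ∃ k, lam k = lam 0 - (p : ℕ)) ∧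
  (∀ j, A.1 (.inl j) (Fin.last _) ≠ A.1 (.inr (.inr j)) (Fin.last _)) ∧
  (∀ c, A.1 (.inr (.inl c)) (Fin.last _) = true ↔ M ≠ BC) ∧
  (∀ r p, localRule (M.cell r p) (west A r p) (east A r p) (north A r p) (south A r p))

instance (M : IceModel) {n : ℕ} [NeZero n] (lam : Fin n → ℕ) :
    DecidablePred (M.Admissible lam) := fun A => by
  unfold Admissible; infer_instance

/-- The six Boltzmann weights attached to a spectral index. -/
structure VertexWeights (R : Type*) where
  a1 : R
  a2 : R
  b1 : R
  b2 : R
  c1 : R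
  c2 : R

/-- The weights for the index `j̄` in terms of those for `j`. -/
def VertexWeights.bar {R : Type*} (x : VertexWeights R) : VertexWeights R where
  a1 := x.a2
  a2 := x.a1
  b1 := x.b2
  b2 := x.b1
  c1 := x.c1
  c2 := x.c2

/-- The weight of a vertex: with the inward arrows in positions `NW`, `SE`, `SW`, `NE`, `NS`, `EW`,
it is `a1`, `a2`, `b1`, `b2`, `c1`, `c2`. -/
def VertexWeights.weight {R : Type*} [Zero R] (x : VertexWeights R) : (w e nn s : Bool) → R
  | true, true, true, true => x.a1
  | false, false, false, false => x.a2
  | true, true, false, false => x.b1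
  | false, false, true, true => x.b2
  | false, true, true, false => x.c1
  | true, false, false, true => x.c2
  | _, _, _, _ => 0

/-- A choice of Boltzmann weights with values in `R` for a model with `m` bends: vertex weights for
the upper rows, the weights `a`, `b`, `c₁`, `c₂` of the central row, the weights `D`, `U` of the
bends (`D`: the arrow runs from row `j` to row `j̄`) and the weights `R`, `L` of the corner (`R`: the
central row points to the right).  Weights that do not occur in a model play no role. -/
structure Weights (m : ℕ) (R : Type*) where
  row : Fin m → VertexWeights R
  a0 : R
  b0 : R
  c10 : R
  c20 : R
  D : Fin m → R
  U : Fin m → R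
  cornerR : R
  cornerL : R

section

variable {R : Type*} [CommRing R]

/-- The vertex weights in each row; those of the lower rows and of the central row are determined by
the symmetry conditions. -/
def rowWeights {M : IceModel} {n : ℕ} (w : Weights (M.bends n) R) : M.Row n → VertexWeights R
  | .inl j => w.row j
  | .inr (.inl _) => ⟨w.a0, w.a0, w.b0, w.b0, w.c10, w.c20⟩
  | .inr (.inr j) => (w.row j).bar

/-- The factor contributed by the place `(r, p)`. -/
def cellWeight {M : IceModel} {n l : ℕ} (w : Weights (M.bends n) R) (A : M.Config n l)
    (r : M.Row n) (p : Fin (M.cols l)) : R :=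
  match M.cell r p with
  | .vertex => (rowWeights w r).weight (west A r p) (east A r p) (north A r p) (south A r p)
  | .crossing => 1
  | .corner => if west A r p = true then w.cornerR else w.cornerL

/-- The Boltzmann weight of a state. -/
def stateWeight {M : IceModel} {n l : ℕ} (w : Weights (M.bends n) R) (A : M.Config n l) : R :=
  (∏ r, ∏ p, cellWeight w A r p) *
    ∏ j, if A.1 (.inl j) (Fin.last _) = true then w.D j else w.U j

/-- The partition function. -/
def partitionFunction (M : IceModel) {n : ℕ} [NeZero n] (lam : Fin n → ℕ)
    (w : Weights (M.bends n) R) : R :=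
  ∑ A : M.Config n (lam 0) with M.Admissible lam A, stateWeight w A

/-- The weights are at the free-fermion point. -/
def FreeFermionic {m : ℕ} (w : Weights m R) : Prop :=
  (∀ j, (w.row j).a1 * (w.row j).a2 + (w.row j).b1 * (w.row j).b2
    = (w.row j).c1 * (w.row j).c2) ∧
  w.a0 ^ 2 + w.b0 ^ 2 = w.c10 * w.c20

/-- The conventional value of `D`, where `i` is a square root of `-1`. -/
def bendD (M : IceModel) (i : R) : R :=
  match M with
  | B => i
  | C => i
  | _ => 1

/-- The conventional weights of the bends and of the corner. -/
def ConventionalBends (M : IceModel) (i : R) {m : ℕ} (w : Weights m R) : Prop :=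
  (∀ j, w.D j = M.bendD i ∧ w.U j = 1) ∧
  (M = C → w.cornerR = 1 ∧ w.cornerL = w.a0 - i * w.b0)

/-- The deformed Weyl denominator of the model, where `i` is a square root of `-1`. -/
def denominator (M : IceModel) {n m : ℕ} (lam : Fin n → ℕ) (i : R) (w : Weights m R) : R :=
  (∏ j,
    match M with
    | B => (w.row j).a2 + i * (w.row j).b1
    | Bstar => w.a0 * (w.row j).a2 + (w.row j).b1 * w.b0
    | C => ((w.row j).a2 + i * (w.row j).b1) * (w.a0 * (w.row j).a2 + (w.row j).b1 * w.b0)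
    | Cstar => (w.row j).a2 ^ 2 + (w.row j).b1 ^ 2
    | D => if ∃ k, lam k = 1 then 1 else (w.row j).a2 ^ 2 + (w.row j).b1 ^ 2
    | BC => (w.a0 * (w.row j).a2 + (w.row j).b1 * w.b0) *
        ((w.row j).a2 ^ 2 + (w.row j).b1 ^ 2)) *
  ∏ j, ∏ k ∈ Finset.Ioi j,
    ((w.row k).a1 * (w.row j).a2 + (w.row j).b1 * (w.row k).b2) *
      ((w.row j).a2 * (w.row k).a2 + (w.row k).b1 * (w.row j).b1)

end

/-- The independent Boltzmann weights as indeterminates; `a0`, `b0` belong to the central row. -/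
inductive Var (m : ℕ)
  | a1 (j : Fin m)
  | a2 (j : Fin m)
  | b1 (j : Fin m)
  | b2 (j : Fin m)
  | a0
  | b0

/-- Permutation of the spectral indices. -/
def Var.permute {m : ℕ} (σ : Equiv.Perm (Fin m)) : Var m → Var m
  | a1 j => a1 (σ j)
  | a2 j => a2 (σ j)
  | b1 j => b1 (σ j)
  | b2 j => b2 (σ j)
  | a0 => a0
  | b0 => b0

/-- The replacement of the spectral index `j` by `j̄`. -/
def Var.flip {m : ℕ} (j : Fin m) : Var m → Var m
  | a1 k => if k = j then a2 k else a1 k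
  | a2 k => if k = j then a1 k else a2 k
  | b1 k => if k = j then b2 k else b1 k
  | b2 k => if k = j then b1 k else b2 k
  | a0 => a0
  | b0 => b0

/-- The values of the indeterminates under a choice of weights. -/
def Weights.assign {m : ℕ} {R : Type*} (w : Weights m R) : Var m → R
  | .a1 j => (w.row j).a1
  | .a2 j => (w.row j).a2
  | .b1 j => (w.row j).b1
  | .b2 j => (w.row j).b2
  | .a0 => w.a0
  | .b0 => w.b0

/-- The Gaussian integer `i`. -/
def gaussI : GaussianInt := ⟨0, 1⟩

open MvPolynomial in
/-- The generic free-fermionic weights with `c₂ = 1`, hence `c₁ = a₁ a₂ + b₁ b₂`, and with the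
conventional weights of the bends and of the corner. -/
noncomputable def genericWeights (M : IceModel) (m : ℕ) :
    Weights m (MvPolynomial (Var m) GaussianInt) where
  row j :=
    { a1 := X (.a1 j)
      a2 := X (.a2 j)
      b1 := X (.b1 j)
      b2 := X (.b2 j)
      c1 := X (.a1 j) * X (.a2 j) + X (.b1 j) * X (.b2 j)
      c2 := 1 }
  a0 := X .a0
  b0 := X .b0
  c10 := X .a0 ^ 2 + X .b0 ^ 2
  c20 := 1
  D _ := M.bendD (MvPolynomial.C gaussI)
  U _ := 1
  cornerR := 1
  cornerL := X .a0 - MvPolynomial.C gaussI * X .b0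

end IceModel

/-!
The argument is the train argument of exactly solvable lattice models, followed by a divisibility
argument in a polynomial ring.

*Transfer operators.* A column acts as a linear operator on functions of the orientations of the
horizontal edges, and the partition function `Z` results from letting the operators of all columns
act on the weight of the right boundary (`partitionFunction_eq_transfer`). Two adjacent rows can be
crossed: free-fermionic weights satisfy a Yang-Baxter equation (`yangBaxter_weight`), by which a
crossing moves through a column while the weights of the two rows are exchanged (`column_braid`). At
the left boundary, where all edges point inward, a crossing has only one state and contributes a
factor. It can hence be attached there and moved to the right boundary (`transfer_column_swap`),
where it has to be absorbed.

*Boundary relations.* Two nested bends absorb the crossing of their upper rows together with that of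
their lower rows (`nested_bends_relation`). This relates `Z` to the partition function with two
neighbouring spectral indices exchanged (`partitionFunction_swap`). The innermost bend absorbs the
crossing of its two rows, or, if there is a central row, the three crossings that reverse the order
of three rows; where there is a half column, it is absorbed at the same time (`bend_relation_i`,
`half_bend_relation`, `bend_relation_outward`, `bend_relation_inward`, `corner_bend_relation`). This
relates `Z` to the partition function with the innermost index inverted (`partitionFunction_flip`).
The factors in these relations are those by which the denominator `F` changes, so that the generic
`Z / F` is invariant under generators of the hyperoctahedral group, and therefore under the whole
group (`proportional_permute`, `proportional_flip`, `proportional_flipSet`).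

*Divisibility.* Let `F'` be the image of `F` under the inversion of all spectral indices, and `Z'`
that of `Z`. Then `Z F' = Z' F`. The elementary factors of `F` are irreducible, and none of them
divides `F'`, as is seen by evaluation at suitable Gaussian integers (`isRelPrime_denominator`).
Hence `F` divides `Z`, and the quotient inherits the invariance.

*Arbitrary weights.* A change of gauge turns the weights `c₂` into `1` at the cost of a factor `c₂`
for each bend, and for the central row if its right edge points inward
(`partitionFunction_eq_mul_normalize`). Normalized weights are specializations of the generic ones
(`map_eval₂_genericWeights`).
-/

namespace IceModel

open Function

/-! ### Transfer operators of columns -/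

section Transfer

variable {R : Type*} {ι : Type*} [DecidableEq ι] {N : ℕ}

/-- The successive action of the transfer operators of the columns in positions `0, ..., c - 1`. -/
def transfer {S : Type*} (T : ℕ → (S → R) → S → R) : ℕ → (S → R) → S → R
  | 0, f => f
  | c + 1, f => transfer T c (T c f)

variable [CommRing R]

/-- The operator of a crossing of the strands `r` and `s` with local weight `B`. -/
def braid (r s : ι) (B : Bool → Bool → Bool → Bool → R) (f : (ι → Bool) → R) (σ : ι → Bool) : R :=
  ∑ a, ∑ b, B (σ r) (σ s) a b * f (update (update σ r a) s b)

/-- A crossing that passes through each column, changing the operator of the column, passes through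
all of them. -/
theorem transfer_braid {T T' : ℕ → ((ι → Bool) → R) → (ι → Bool) → R} {r s : ι}
    {B : Bool → Bool → Bool → Bool → R} {c : ℕ}
    (h : ∀ p < c, ∀ f, T p (braid r s B f) = braid r s B (T' p f)) (f : (ι → Bool) → R) :
    transfer T c (braid r s B f) = braid r s B (transfer T' c f) := by
  induction c generalizing f with
  | zero => rfl
  | succ c ih =>
    rw [transfer, transfer, h c (Nat.lt_succ_self c), ih fun p hp => h p (hp.trans c.lt_succ_self)]

/-- If all edges on the left of a crossing point to the right, then so do those on its right. -/
theorem braid_top {r s : ι} {B : Bool → Bool → Bool → Bool → R}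
    (hB : ∀ a b, a = false ∨ b = false → B true true a b = 0) (f : (ι → Bool) → R) :
    braid r s B f (fun _ => true) = B true true true true * f (fun _ => true) := by
  simp [braid, hB]

variable [Fintype ι]

/-- A sum over Boolean vectors, arranged by the values of the coordinates other than `k`; the
vectors with `k`-th coordinate `true` serve as representatives. -/
theorem sum_eq_sum_filter_update {κ : Type*} [Fintype κ] [DecidableEq κ] (k : κ)
    (F : (κ → Bool) → R) :
    ∑ v, F v = ∑ v with v k = true, ∑ b, F (update v k b) := by
  rw [← Finset.sum_filter_add_sum_filter_not Finset.univ (fun v : κ → Bool => v k = true)]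
  simp_rw [Fintype.sum_bool, Finset.sum_add_distrib]
  congr 1
  · refine Finset.sum_congr rfl fun v hv => ?_
    rw [← (Finset.mem_filter.1 hv).2, update_eq_self]
  · refine Finset.sum_nbij' (fun v => update v k true) (fun v => update v k false) ?_ ?_ ?_ ?_ ?_
    · simp
    · simp
    · intro v hv
      have : v k = false := by simpa using hv
      simp [← this]
    · intro v hv
      have : v k = true := by simpa using hv
      simp [← this]
    · intro v hv
      have : v k = false := by simpa using hv
      simp [← this]

/-- Two sums over Boolean vectors agree if they agree after summation over one coordinate. -/
theorem sum_congr_update {κ : Type*} [Fintype κ] [DecidableEq κ] (k : κ)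
    {F G : (κ → Bool) → R}
    (h : ∀ v, ∑ b, F (update v k b) = ∑ b, G (update v k b)) : ∑ v, F v = ∑ v, G v := by
  rw [sum_eq_sum_filter_update k, sum_eq_sum_filter_update k]
  exact Finset.sum_congr rfl fun v _ => h v

/-- Two sums over Boolean vectors agree if they agree after summation over two coordinates. -/
theorem sum_congr_update₂ {κ : Type*} [Fintype κ] [DecidableEq κ] {k l : κ} (hkl : k ≠ l)
    {F G : (κ → Bool) → R}
    (h : ∀ v, ∑ a, ∑ b, F (update (update v k a) l b) = ∑ a, ∑ b, G (update (update v k a) l b)) :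
    ∑ v, F v = ∑ v, G v := by
  rw [sum_eq_sum_filter_update l, sum_eq_sum_filter_update l, Finset.sum_filter, Finset.sum_filter]
  refine sum_congr_update k fun v => ?_
  simp only [update_of_ne hkl.symm]
  split_ifs
  · exact h v
  · rfl

/-- The transfer operator of a column: `W r` is the local weight at row `r` as a function of the
west, east, north and south edges, `t` is the orientation of the top edge, and the bottom edge
points down. It acts on functions of the horizontal edges to the right of the column. -/
def colOp (lev : ι → Fin N) (W : ι → Bool → Bool → Bool → Bool → R) (t : Bool)
    (f : (ι → Bool) → R) (σ : ι → Bool) : R :=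
  ∑ v : Fin (N + 1) → Bool, ∑ τ : ι → Bool,
    (if v 0 = t ∧ v (Fin.last N) = true then 1 else 0) *
      (∏ r, W r (σ r) (τ r) (v (lev r).castSucc) (v (lev r).succ)) * f τ

theorem prod_eq_mul_mul_prod {r s : ι} (h : r ≠ s) (X : ι → R) :
    ∏ q, X q = X r * X s * ∏ q ∈ (Finset.univ.erase r).erase s, X q := by
  rw [mul_assoc, Finset.mul_prod_erase _ X (by simp [h.symm]), Finset.mul_prod_erase _ X (by simp)]

/-- The Yang-Baxter equation: a crossing `B` passes through a pair of adjacent vertices. -/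
def YangBaxter (B W₁ W₂ W₁' W₂' : Bool → Bool → Bool → Bool → R) : Prop :=
  ∀ a b c d u v, ∑ x, ∑ y, ∑ m, W₁ a x u m * W₂ b y m v * B x y c d =
    ∑ x, ∑ y, ∑ m, B a b x y * (W₁' x c u m * W₂' y d m v)

/-- A solution of the Yang-Baxter equation passes through a column, in which the weights of the two
rows concerned change from `W` to `W'`. -/
theorem colOp_braid {lev : ι → Fin N} (hlev : Injective lev) {r s : ι}
    (hrs : (lev r).succ = (lev s).castSucc) {W W' : ι → Bool → Bool → Bool → Bool → R}
    (hW : ∀ q, q ≠ r → q ≠ s → W q = W' q) {B : Bool → Bool → Bool → Bool → R}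
    (hB : YangBaxter B (W r) (W s) (W' r) (W' s)) (t : Bool) (f : (ι → Bool) → R) :
    colOp lev W t (braid r s B f) = braid r s B (colOp lev W' t f) := by
  have hne : r ≠ s := by
    rintro rfl
    exact absurd (congrArg Fin.val hrs) (by simp)
  funext σ
  have hupd : ∀ (τ : ι → Bool) (x y c d : Bool),
      update (update (update (update τ r x) s y) r c) s d = update (update τ r c) s d := by
    intro τ x y c d
    rw [update_comm hne, update_idem, update_comm hne, update_idem, update_comm hne.symm]
  unfold colOp braid
  simp_rw [Finset.mul_sum (Finset.univ : Finset (Fin (N + 1) → Bool))]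
  conv_rhs =>
    enter [2, a]
    rw [Finset.sum_comm]
  conv_rhs => rw [Finset.sum_comm]
  -- Fix all edges but the vertical edge between the two rows and the two horizontal edges on the
  -- right: what remains is the Yang-Baxter equation.
  refine sum_congr_update (lev r).succ fun v => ?_
  simp_rw [Finset.mul_sum (Finset.univ : Finset (ι → Bool))]
  conv_rhs =>
    enter [2, m]
    conv =>
      enter [2, a]
      rw [Finset.sum_comm]
    rw [Finset.sum_comm]
  rw [Finset.sum_comm]
  conv_rhs => rw [Finset.sum_comm]
  refine sum_congr_update₂ hne fun τ => ?_
  have key : ∀ (V : ι → Bool → Bool → Bool → Bool → R) (σ : ι → Bool) (x y m : Bool),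
      (if update v (lev r).succ m 0 = t ∧ update v (lev r).succ m (Fin.last N) = true
        then 1 else 0) * (∏ q, V q (σ q) (update (update τ r x) s y q)
          (update v (lev r).succ m (lev q).castSucc) (update v (lev r).succ m (lev q).succ)) =
      (if v 0 = t ∧ v (Fin.last N) = true then 1 else 0) *
        (∏ q ∈ (Finset.univ.erase r).erase s, V q (σ q) (τ q) (v (lev q).castSucc)
          (v (lev q).succ)) *
        (V r (σ r) x (v (lev r).castSucc) m * V s (σ s) y m (v (lev s).succ)) := by
    intro V σ x y m
    have h0 : (0 : Fin (N + 1)) ≠ (lev r).succ := (Fin.succ_ne_zero _).symm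
    have h1 : Fin.last N ≠ (lev r).succ := hrs ▸ (Fin.castSucc_lt_last _).ne'
    have h2 : (lev r).castSucc ≠ (lev r).succ := Fin.castSucc_lt_succ.ne
    have h3 : (lev s).succ ≠ (lev r).succ := hrs ▸ Fin.castSucc_lt_succ.ne'
    rw [prod_eq_mul_mul_prod hne]
    simp only [update_of_ne h0, update_of_ne h1, update_of_ne h2, update_of_ne h3, update_self,
      ← hrs, update_of_ne hne]
    rw [Finset.prod_congr rfl (g := fun q => V q (σ q) (τ q) (v (lev q).castSucc)
          (v (lev q).succ))]
    · ring
    · intro q hq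
      simp only [Finset.mem_erase, Finset.mem_univ, and_true] at hq
      have h4 : (lev q).castSucc ≠ (lev r).succ := fun h =>
        hq.1 (hlev (Fin.castSucc_injective _ (h.trans hrs)))
      have h5 : (lev q).succ ≠ (lev r).succ := fun h => hq.2 (hlev (Fin.succ_injective _ h))
      simp only [update_of_ne h4, update_of_ne h5, update_of_ne hq.1, update_of_ne hq.2]
  have hrest : ∀ a b : Bool, ∏ q ∈ (Finset.univ.erase r).erase s,
      W' q (update (update σ r a) s b q) (τ q) (v (lev q).castSucc) (v (lev q).succ) =
      ∏ q ∈ (Finset.univ.erase r).erase s,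
        W q (σ q) (τ q) (v (lev q).castSucc) (v (lev q).succ) := by
    intro a b
    refine Finset.prod_congr rfl fun q hq => ?_
    simp only [Finset.mem_erase, Finset.mem_univ, and_true] at hq
    rw [hW q hq.2 hq.1, update_of_ne hq.1, update_of_ne hq.2]
  simp only [key, hrest, hupd, update_self, update_of_ne hne]
  generalize (if v 0 = t ∧ v (Fin.last N) = true then (1 : R) else 0) *
    ∏ q ∈ (Finset.univ.erase r).erase s, W q (σ q) (τ q) (v (lev q).castSucc) (v (lev q).succ) = P
  have hB' := fun c d => hB (σ r) (σ s) c d (v (lev r).castSucc) (v (lev s).succ)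
  generalize v (lev r).castSucc = u at *
  generalize v (lev s).succ = u' at *
  simp only [Fintype.sum_bool] at hB' ⊢
  linear_combination P * f (update (update τ r true) s true) * hB' true true +
    P * f (update (update τ r true) s false) * hB' true false +
    P * f (update (update τ r false) s true) * hB' false true +
    P * f (update (update τ r false) s false) * hB' false false

theorem transfer_smul {S : Type*} {T : ℕ → (S → R) → S → R}
    (hT : ∀ p (κ : R) f, T p (fun σ => κ * f σ) = fun σ => κ * T p f σ) (c : ℕ) (κ : R)
    (f : S → R) : transfer T c (fun σ => κ * f σ) = fun σ => κ * transfer T c f σ := by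
  induction c generalizing f with
  | zero => rfl
  | succ c ih => rw [transfer, transfer, hT, ih]

theorem colOp_smul (lev : ι → Fin N) (W : ι → Bool → Bool → Bool → Bool → R) (t : Bool) (κ : R)
    (f : (ι → Bool) → R) : colOp lev W t (fun σ => κ * f σ) = fun σ => κ * colOp lev W t f σ := by
  funext σ
  simp only [colOp, Finset.mul_sum]
  exact Finset.sum_congr rfl fun _ _ => Finset.sum_congr rfl fun _ _ => by ring

/-- A change of gauge: weights that differ by factors attached to the horizontal edges. -/
theorem colOp_gauge {lev : ι → Fin N} {W W' : ι → Bool → Bool → Bool → Bool → R}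
    {g : ι → Bool → R} (h : ∀ r a b u v, g r a * W r a b u v = W' r a b u v * g r b) (t : Bool)
    (f : (ι → Bool) → R) (σ : ι → Bool) :
    (∏ r, g r (σ r)) * colOp lev W t f σ = colOp lev W' t (fun τ => (∏ r, g r (τ r)) * f τ) σ := by
  simp only [colOp, Finset.mul_sum]
  refine Finset.sum_congr rfl fun v _ => Finset.sum_congr rfl fun τ _ => ?_
  have : (∏ r, g r (σ r)) * ∏ r, W r (σ r) (τ r) (v (lev r).castSucc) (v (lev r).succ) =
      (∏ r, W' r (σ r) (τ r) (v (lev r).castSucc) (v (lev r).succ)) * ∏ r, g r (τ r) := by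
    rw [← Finset.prod_mul_distrib, ← Finset.prod_mul_distrib]
    exact Finset.prod_congr rfl fun r _ => h _ _ _ _ _
  linear_combination (if v 0 = t ∧ v (Fin.last N) = true then (1 : R) else 0) * f τ * this

/-- Intertwining of the transfer operators of the single columns by multiplication with `G`. -/
theorem transfer_gauge {S : Type*} {T T' : ℕ → (S → R) → S → R} {G : S → R} {c : ℕ}
    (h : ∀ p < c, ∀ f σ, G σ * T p f σ = T' p (fun τ => G τ * f τ) σ) (f : S → R) (σ : S) :
    G σ * transfer T c f σ = transfer T' c (fun τ => G τ * f τ) σ := by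
  induction c generalizing f with
  | zero => rfl
  | succ c ih =>
    rw [transfer, transfer, ih fun p hp => h p (hp.trans c.lt_succ_self)]
    congr 1
    exact funext (h c c.lt_succ_self f)

/-- The iterated action of integral operators as a sum over paths. -/
theorem transfer_eq_sum {S : Type*} [Fintype S] [DecidableEq S] (K : ℕ → S → S → R) (c : ℕ)
    (f : S → R) (σ : S) :
    transfer (fun p f σ => ∑ τ, K p σ τ * f τ) c f σ =
      ∑ H : Fin (c + 1) → S, (if H 0 = σ then 1 else 0) *
        (∏ p : Fin c, K p (H p.castSucc) (H p.succ)) * f (H (Fin.last c)) := by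
  induction c generalizing f with
  | zero =>
    refine Eq.trans ?_ ((Equiv.funUnique (Fin 1) S).symm.sum_comp fun H =>
      (if H 0 = σ then (1 : R) else 0) * (∏ p : Fin 0, K p (H p.castSucc) (H p.succ)) *
        f (H (Fin.last 0)))
    simp [transfer]
  | succ c ih =>
    refine Eq.trans ?_ ((Fin.snocEquiv fun _ : Fin (c + 2) => S).sum_comp fun H =>
      (if H 0 = σ then (1 : R) else 0) * (∏ p : Fin (c + 1), K p (H p.castSucc) (H p.succ)) *
        f (H (Fin.last (c + 1))))
    rw [transfer, ih, Fintype.sum_prod_type, Finset.sum_comm]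
    refine Finset.sum_congr rfl fun H _ => ?_
    rw [Finset.mul_sum]
    refine Finset.sum_congr rfl fun τ _ => ?_
    rw [Fin.prod_univ_castSucc]
    simp only [Fin.snocEquiv_apply, Fin.snoc_last, Fin.succ_last, ← Fin.castSucc_succ,
      Fin.snoc_castSucc, Fin.val_castSucc, Fin.val_last]
    have h0 : Fin.snoc (α := fun _ => S) H τ 0 = H 0 := Fin.snoc_castSucc (α := fun _ => S) τ H 0
    rw [h0]
    ring

end Transfer

/-! ### The partition function as a matrix element of a product of transfer operators -/

section Columns

variable {R : Type*} [CommRing R] {M : IceModel} {n : ℕ}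

/-- What sits in row `r` of the prolonged half column. -/
def halfCell : M.Row n → Cell
  | .inl _ => .crossing
  | .inr (.inl _) => .corner
  | .inr (.inr _) => .vertex

/-- What sits at row `r` and column position `p` if the greatest part is `l`. -/
def cellAt (l : ℕ) (r : M.Row n) (p : ℕ) : Cell :=
  if M.hasHalfColumn = true ∧ p + 1 = M.cols l then halfCell r else .vertex

theorem cell_eq_cellAt {l : ℕ} (r : M.Row n) (p : Fin (M.cols l)) :
    M.cell r p = cellAt l r p := by
  unfold cell cellAt
  rcases r with _ | _ | _ <;> rfl

/-- The local weight at a place as a function of its four edges, zero if the local condition fails.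
In the prolonged half column the vertical line crosses the upper rows freely, so that there it keeps
the orientation `t` of its top edge; this is made part of the local condition. -/
def cellFun (x : VertexWeights R) (cR cL : R) (t : Bool) :
    Cell → Bool → Bool → Bool → Bool → R
  | .vertex, w, e, nn, s => x.weight w e nn s
  | .crossing, w, e, nn, s => if w = e ∧ nn = t ∧ s = t then 1 else 0
  | .corner, w, _, _, s => if w = s then (if w = true then cR else cL) else 0

/-- The transfer operator of the column in position `p`, with vertex weights `ρ r` in row `r`. -/
def column (l : ℕ) (ρ : M.Row n → VertexWeights R) (cR cL : R) (t : ℕ → Bool) (p : ℕ) :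
    ((M.Row n → Bool) → R) → (M.Row n → Bool) → R :=
  colOp level (fun r => cellFun (ρ r) cR cL (t p) (cellAt l r p)) (t p)

/-- The top edge of the column in position `p` points down unless its label is a part. -/
def topEdge [NeZero n] (lam : Fin n → ℕ) (p : ℕ) : Bool := decide ¬∃ k, lam k = lam 0 - p

/-- The weight of the right boundary as a function of the horizontal edges at the right. -/
def boundary (D U : Fin (M.bends n) → R) (σ : M.Row n → Bool) : R :=
  (∏ j, if σ (.inl j) = σ (.inr (.inr j)) then 0 else if σ (.inl j) = true then D j else U j) *
    ∏ c, if σ (.inr (.inl c)) = true ↔ M ≠ BC then 1 else 0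

theorem level_injective : Injective (level : M.Row n → Fin (M.numRows n)) := by
  intro r s h
  have h' := congrArg Fin.val h
  rcases r with ⟨i, hi⟩ | ⟨i, hi⟩ | ⟨i, hi⟩ <;> rcases s with ⟨j, hj⟩ | ⟨j, hj⟩ | ⟨j, hj⟩ <;>
    simp only [level] at h' <;> first
    | (obtain rfl : i = j := by omega); rfl
    | omega

theorem weight_eq_zero {x : VertexWeights R} {w e nn s : Bool}
    (h : ¬localRule .vertex w e nn s) : x.weight w e nn s = 0 := by
  revert h
  cases w <;> cases e <;> cases nn <;> cases s <;> simp [localRule, VertexWeights.weight]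

/-- In an admissible state the prolonged half column keeps its orientation down to the first row
below the upper ones. -/
theorem Admissible.vertical_eq_top [NeZero n] {lam : Fin n → ℕ} {A : M.Config n (lam 0)}
    (hA : M.Admissible lam A) {p : Fin (M.cols (lam 0))} (hM : M.hasHalfColumn = true)
    (hp : (p : ℕ) + 1 = M.cols (lam 0)) (k : ℕ) (hk : k ≤ M.bends n)
    (hk' : k < M.numRows n + 1) : A.2 ⟨k, hk'⟩ p = topEdge lam p := by
  induction k with
  | zero =>
    have := hA.2.2.1 p
    rw [show (⟨0, hk'⟩ : Fin (M.numRows n + 1)) = 0 from rfl]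
    unfold topEdge
    by_cases h : ∃ k, lam k = lam 0 - (p : ℕ)
    · simpa [h] using this
    · simpa [h] using this
  | succ k ih =>
    have h := hA.2.2.2.2.2 (.inl ⟨k, hk⟩) p
    rw [cell_eq_cellAt, cellAt, if_pos ⟨hM, hp⟩] at h
    exact h.2.symm.trans (ih (by omega) (by omega))

/-- The weight of an orientation, extended by zero to the inadmissible ones, as a product over the
left boundary, the columns and the right boundary. -/
theorem state_weight_eq [NeZero n] (lam : Fin n → ℕ) (w : Weights (M.bends n) R)
    (A : M.Config n (lam 0)) :
    (if M.Admissible lam A then stateWeight w A else 0) =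
      (if (fun r => A.1 r 0) = (fun _ => true) then 1 else 0) *
        (∏ p : Fin (M.cols (lam 0)),
          ((if A.2 0 p = topEdge lam p ∧ A.2 (Fin.last _) p = true then 1 else 0) *
            ∏ r, cellFun (rowWeights w r) w.cornerR w.cornerL (topEdge lam p)
              (cellAt (lam 0) r p) (A.1 r p.castSucc) (A.1 r p.succ)
              (A.2 (level r).castSucc p) (A.2 (level r).succ p))) *
        boundary w.D w.U (fun r => A.1 r (Fin.last _)) := by
  have htop : ∀ p : Fin (M.cols (lam 0)), (A.2 0 p = topEdge lam p ↔
      (A.2 0 p = false ↔ ∃ k, lam k = lam 0 - (p : ℕ))) := by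
    intro p
    unfold topEdge
    by_cases h : ∃ k, lam k = lam 0 - (p : ℕ) <;> simp [h]
  by_cases hA : M.Admissible lam A
  on_goal 1 => rw [if_pos hA, if_pos (funext fun r => hA.1 r), one_mul]
  on_goal 2 => rw [if_neg hA]
  · have h1 : ∀ p, (if A.2 0 p = topEdge lam p ∧ A.2 (Fin.last _) p = true then (1 : R) else 0)
        = 1 := fun p => if_pos ⟨(htop p).2 (hA.2.2.1 p), hA.2.1 p⟩
    simp only [h1, one_mul]
    rw [stateWeight, boundary, Finset.prod_comm,
      Finset.prod_eq_one (s := (Finset.univ : Finset (Fin M.central)))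
      fun c _ => if_pos (hA.2.2.2.2.1 c), mul_one]
    congr 1
    · refine Finset.prod_congr rfl fun p _ => Finset.prod_congr rfl fun r _ => ?_
      have hr := hA.2.2.2.2.2 r p
      rw [cellWeight, cell_eq_cellAt] at *
      by_cases hc : M.hasHalfColumn = true ∧ (p : ℕ) + 1 = M.cols (lam 0)
      · rw [cellAt, if_pos hc] at hr ⊢
        rcases r with j | c | j
        · have h2 := hA.vertical_eq_top hc.1 hc.2 j j.isLt.le
            (by have := j.isLt; unfold numRows; omega)
          have h3 := hA.vertical_eq_top hc.1 hc.2 (j + 1) j.isLt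
            (by have := j.isLt; unfold numRows; omega)
          exact (if_pos ⟨hr.1, h2, h3⟩).symm
        · exact (if_pos (c := west A (.inr (.inl c)) p = south A (.inr (.inl c)) p) hr).symm
        · rfl
      · rw [cellAt, if_neg hc]
        rfl
    · exact Finset.prod_congr rfl fun j _ => (if_neg (hA.2.2.2.1 j)).symm
  · -- If the product on the right is not zero, then no factor is, and the state is admissible.
    by_contra hne
    replace hne := Ne.symm hne
    refine hA ?_
    have h0 := not_not.1 fun h => left_ne_zero_of_mul (left_ne_zero_of_mul hne) (if_neg h)
    rw [if_pos h0, one_mul] at hne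
    have hcol : ∀ p, (if A.2 0 p = topEdge lam p ∧ A.2 (Fin.last _) p = true then (1 : R) else 0) *
            ∏ r, cellFun (rowWeights w r) w.cornerR w.cornerL (topEdge lam p)
              (cellAt (lam 0) r p) (A.1 r p.castSucc) (A.1 r p.succ)
              (A.2 (level r).castSucc p) (A.2 (level r).succ p) ≠ 0 := fun p hp =>
      left_ne_zero_of_mul hne (Finset.prod_eq_zero (Finset.mem_univ p) hp)
    have hbd : ∀ p, A.2 0 p = topEdge lam p ∧ A.2 (Fin.last _) p = true := fun p =>
      not_not.1 fun h => left_ne_zero_of_mul (hcol p) (if_neg h)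
    have hb := right_ne_zero_of_mul hne
    refine ⟨fun r => congrFun h0 r, fun p => (hbd p).2, fun p => (htop p).1 (hbd p).1,
      fun j hj => ?_, fun c => ?_, fun r p => ?_⟩
    · exact left_ne_zero_of_mul hb (Finset.prod_eq_zero (Finset.mem_univ j) (if_pos hj))
    · exact not_not.1 fun h =>
        right_ne_zero_of_mul hb (Finset.prod_eq_zero (Finset.mem_univ c) (if_neg h))
    · have hr : cellFun (rowWeights w r) w.cornerR w.cornerL (topEdge lam p)
              (cellAt (lam 0) r p) (A.1 r p.castSucc) (A.1 r p.succ)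
              (A.2 (level r).castSucc p) (A.2 (level r).succ p) ≠ 0 := fun h =>
        right_ne_zero_of_mul (hcol p) (Finset.prod_eq_zero (Finset.mem_univ r) h)
      rw [cell_eq_cellAt]
      unfold west east north south
      generalize cellAt (lam 0) r p = c at *
      refine not_not.1 fun h => hr ?_
      cases c with
      | vertex => exact weight_eq_zero h
      | crossing => exact if_neg fun h' => h ⟨h'.1, h'.2.1.trans h'.2.2.symm⟩
      | corner => exact if_neg h

/-- The partition function is obtained by letting the transfer operators of all columns act on the
weight of the right boundary and evaluating at the left boundary, where all edges point to the
right. -/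
theorem partitionFunction_eq_transfer [NeZero n] (lam : Fin n → ℕ) (w : Weights (M.bends n) R) :
    M.partitionFunction lam w =
      transfer (column (lam 0) (rowWeights w) w.cornerR w.cornerL (topEdge lam)) (M.cols (lam 0))
        (boundary w.D w.U) (fun _ => true) := by
  classical
  have hcol : column (lam 0) (rowWeights w) w.cornerR w.cornerL (topEdge lam) =
      fun p f σ => ∑ τ, (∑ v : Fin (M.numRows n + 1) → Bool,
        (if v 0 = topEdge lam p ∧ v (Fin.last _) = true then 1 else 0) *
          ∏ r, cellFun (rowWeights w r) w.cornerR w.cornerL (topEdge lam p) (cellAt (lam 0) r p)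
            (σ r) (τ r) (v (level r).castSucc) (v (level r).succ)) * f τ := by
    funext p f σ
    simp_rw [column, colOp, Finset.sum_mul]
    exact Finset.sum_comm
  rw [hcol, transfer_eq_sum, partitionFunction, Finset.sum_filter]
  simp_rw [state_weight_eq]
  rw [Fintype.sum_prod_type]
  refine Fintype.sum_equiv (Equiv.piComm fun _ _ => Bool) _ _ fun h => ?_
  -- The product over the columns of sums over the vertical edges of one column is a sum over all
  -- families of vertical edges.
  simp_rw [Finset.prod_univ_sum, Fintype.piFinset_univ, Finset.mul_sum, Finset.sum_mul]
  exact Fintype.sum_equiv (Equiv.piComm fun _ _ => Bool) _ _ fun v => rfl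

end Columns

/-! ### Normalization of the weights -/

section Gauge

variable {R : Type*} [CommRing R] {M : IceModel} {n : ℕ}

/-- Only models of type `C` have a corner: in the types `C_*` and `D` there is no central row. -/
theorem eq_C_of_cellAt_eq_corner {l p : ℕ} {r : M.Row n} (h : cellAt l r p = .corner) :
    M = C := by
  rw [cellAt] at h
  split_ifs at h with hc
  rcases r with _ | c | _
  · cases h
  · cases M with
    | C => rfl
    | Cstar => exact c.elim0
    | D => exact c.elim0
    | _ => simp [hasHalfColumn] at hc
  · cases h

/-- The weights after the change of gauge that makes all `c₂` equal to `1`. -/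
def Weights.normalize {m : ℕ} (w : Weights m R) : Weights m R where
  row j := { w.row j with c1 := (w.row j).c1 * (w.row j).c2, c2 := 1 }
  a0 := w.a0
  b0 := w.b0
  c10 := w.c10 * w.c20
  c20 := 1
  D := w.D
  U := w.U
  cornerR := w.cornerR
  cornerL := w.cornerL

/-- At each vertex the product `c₁ c₂` alone matters up to a factor that belongs to the horizontal
edges: a factor `c₂` for each edge that points to the left. -/
theorem VertexWeights.weight_gauge (x : VertexWeights R) (w e nn s : Bool) :
    (if w = true then 1 else x.c2) * x.weight w e nn s =
      ({ x with c1 := x.c1 * x.c2, c2 := 1 } : VertexWeights R).weight w e nn s *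
        (if e = true then 1 else x.c2) := by
  cases w <;> cases e <;> cases nn <;> cases s <;> simp [VertexWeights.weight, mul_comm]

theorem rowWeights_normalize (w : Weights (M.bends n) R) (r : M.Row n) :
    rowWeights w.normalize r =
      { rowWeights w r with
        c1 := (rowWeights w r).c1 * (rowWeights w r).c2, c2 := 1 } := by
  rcases r with _ | _ | _ <;> rfl

/-- In each row the vertices of types `c₁` and `c₂` alternate, starting with `c₂`. Hence the
partition function depends on the products `c₁ c₂` only, up to one factor `c₂` for each row that
ends with an arrow pointing left. -/
theorem partitionFunction_eq_mul_normalize [NeZero n] (lam : Fin n → ℕ)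
    (w : Weights (M.bends n) R) (hC : M = C → w.c20 = 1) :
    M.partitionFunction lam w = (∏ j, (w.row j).c2) * (if M = BC then w.c20 else 1) *
      M.partitionFunction lam w.normalize := by
  rw [partitionFunction_eq_transfer, partitionFunction_eq_transfer]
  let g : M.Row n → Bool → R := fun r a => if a = true then 1 else (rowWeights w r).c2
  have hg : ∀ p r a b u v, g r a * cellFun (rowWeights w r) w.cornerR w.cornerL (topEdge lam p)
      (cellAt (lam 0) r p) a b u v = cellFun (rowWeights w.normalize r) w.normalize.cornerR
        w.normalize.cornerL (topEdge lam p) (cellAt (lam 0) r p) a b u v * g r b := by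
    intro p r a b u v
    rw [rowWeights_normalize]
    rcases hc : cellAt (lam 0) r p with _ | _ | _
    · exact VertexWeights.weight_gauge _ a b u v
    · by_cases hab : a = b
      · subst hab
        exact mul_comm _ _
      · simp [cellFun, hab]
    · -- The gauge factor of an edge pointing left would be lost where the row turns down.
      have h1 : (rowWeights w r).c2 = 1 := by
        rcases r with _ | _ | _
        · rw [cellAt] at hc
          split_ifs at hc
          cases hc
        · exact hC (eq_C_of_cellAt_eq_corner hc)
        · rw [cellAt] at hc
          split_ifs at hc
          cases hc
      simp [g, h1, cellFun, Weights.normalize]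
  have hbd : ∀ τ, (∏ r, g r (τ r)) * boundary w.D w.U τ =
      ((∏ j, (w.row j).c2) * (if M = BC then w.c20 else 1)) *
        boundary w.normalize.D w.normalize.U τ := by
    intro τ
    have h1 : ∏ _c : Fin M.central, (if M = BC then w.c20 else 1) =
        if M = BC then w.c20 else 1 := by
      split_ifs with h
      · subst h
        exact (Fin.prod_const 1 w.c20).trans (pow_one _)
      · exact Finset.prod_const_one
    rw [← h1, boundary, boundary, Fintype.prod_sum_type, Fintype.prod_sum_type]
    rw [show ∀ a b c d e : R, (a * (b * c)) * (d * e) = (a * c * d) * (b * e) by intros; ring]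
    conv_rhs => rw [mul_mul_mul_comm]
    simp only [← Finset.prod_mul_distrib]
    congr 1
    · refine Finset.prod_congr rfl fun j _ => ?_
      cases h1 : τ (.inl j) <;> cases h2 : τ (.inr (.inr j)) <;>
        simp [g, rowWeights, VertexWeights.bar, Weights.normalize]
    · refine Finset.prod_congr rfl fun c _ => ?_
      cases h1 : τ (.inr (.inl c)) <;> by_cases hM : M = BC <;> simp [g, rowWeights, hM]
  have h := transfer_gauge (c := M.cols (lam 0)) (G := fun σ => ∏ r, g r (σ r))
    (T := column (lam 0) (rowWeights w) w.cornerR w.cornerL (topEdge lam))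
    (T' := column (lam 0) (rowWeights w.normalize) w.normalize.cornerR w.normalize.cornerL
      (topEdge lam))
    (fun p _ f σ => colOp_gauge (hg p) (topEdge lam p) f σ) (boundary w.D w.U) (fun _ => true)
  simp only [hbd] at h
  rw [transfer_smul (T := column _ _ _ _ _) fun p κ f => colOp_smul _ _ _ κ f] at h
  refine Eq.trans ?_ h
  simp [g]

end Gauge

/-! ### Naturality in the ring of weights -/

section Naturality

variable {R S : Type*} [CommRing R] [CommRing S] {M : IceModel} {n : ℕ}

/-- The image of a choice of weights under a ring homomorphism. -/
def Weights.map {m : ℕ} (f : R →+* S) (w : Weights m R) : Weights m S where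
  row j := ⟨f (w.row j).a1, f (w.row j).a2, f (w.row j).b1, f (w.row j).b2, f (w.row j).c1,
    f (w.row j).c2⟩
  a0 := f w.a0
  b0 := f w.b0
  c10 := f w.c10
  c20 := f w.c20
  D j := f (w.D j)
  U j := f (w.U j)
  cornerR := f w.cornerR
  cornerL := f w.cornerL

theorem map_weight_rowWeights (f : R →+* S) (w : Weights (M.bends n) R) (r : M.Row n)
    (a b u v : Bool) :
    f ((rowWeights w r).weight a b u v) = (rowWeights (w.map f) r).weight a b u v := by
  rcases r with _ | _ | _ <;> cases a <;> cases b <;> cases u <;> cases v <;>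
    simp [rowWeights, VertexWeights.weight, VertexWeights.bar, Weights.map]

theorem map_partitionFunction [NeZero n] (f : R →+* S) (lam : Fin n → ℕ)
    (w : Weights (M.bends n) R) :
    f (M.partitionFunction lam w) = M.partitionFunction lam (w.map f) := by
  simp only [partitionFunction, stateWeight, map_sum, map_mul, map_prod]
  refine Finset.sum_congr rfl fun A _ => ?_
  congr 1
  · refine Finset.prod_congr rfl fun r _ => Finset.prod_congr rfl fun p _ => ?_
    unfold cellWeight
    cases M.cell r p with
    | vertex => exact map_weight_rowWeights f w r _ _ _ _
    | crossing => exact map_one f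
    | corner => exact apply_ite f _ _ _
  · exact Finset.prod_congr rfl fun j _ => apply_ite f _ _ _

theorem map_denominator (f : R →+* S) {m : ℕ} (lam : Fin n → ℕ) (i : R) (w : Weights m R) :
    f (M.denominator lam i w) = M.denominator lam (f i) (w.map f) := by
  simp only [denominator, map_mul, map_prod, map_add]
  congr 1
  refine Finset.prod_congr rfl fun j _ => ?_
  cases M <;> simp [Weights.map, apply_ite f]

/-- The corner weights matter in type `C` only. -/
theorem partitionFunction_congr_corner [NeZero n] (lam : Fin n → ℕ) (w : Weights (M.bends n) R)
    (x y : R) (h : M = C → x = w.cornerR ∧ y = w.cornerL) :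
    M.partitionFunction lam { w with cornerR := x, cornerL := y } = M.partitionFunction lam w := by
  refine Finset.sum_congr rfl fun A _ => ?_
  unfold stateWeight
  congr 1
  refine Finset.prod_congr rfl fun r _ => Finset.prod_congr rfl fun p _ => ?_
  unfold cellWeight
  have hC : M.cell r p = .corner → M = C := fun hc =>
    eq_C_of_cellAt_eq_corner ((cell_eq_cellAt r p).symm.trans hc)
  revert hC
  cases M.cell r p with
  | vertex => exact fun _ => rfl
  | crossing => exact fun _ => rfl
  | corner =>
    intro hC
    obtain ⟨rfl, rfl⟩ := h (hC rfl)
    rfl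

end Naturality

/-! ### The Yang-Baxter equation and the boundary relations -/

section YangBaxter

variable {R : Type*} [CommRing R]

/-- Free-fermionic vertex weights with `c₂ = 1`. -/
def VertexWeights.IsNormal (x : VertexWeights R) : Prop :=
  x.c1 = x.a1 * x.a2 + x.b1 * x.b2 ∧ x.c2 = 1

/-- The weights of a crossing of two strands that carry the spectral data `x` (above) and `y`
(below) on the left, as a function of the two edges on the left and the two edges on the right;
an edge is `true` if it points to the right. -/
def crossWeight (x y : VertexWeights R) : Bool → Bool → Bool → Bool → R :=
  fun a b c d =>
    bif a then
      bif b then bif c && d then x.b1 * y.b2 + x.a2 * y.a1 else 0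
      else bif c then bif d then 0 else y.c1
        else bif d then x.a1 * y.b2 - x.b2 * y.a1 else 0
    else
      bif b then bif c then bif d then 0 else x.a2 * y.b1 - x.b1 * y.a2
        else bif d then x.c1 else 0
      else bif c || d then 0 else x.a1 * y.a2 + x.b2 * y.b1

theorem VertexWeights.weight_eq (x : VertexWeights R) (w e nn s : Bool) :
    x.weight w e nn s =
      bif w then
        bif e then bif nn then bif s then x.a1 else 0 else bif s then 0 else x.b1
        else bif nn then 0 else bif s then x.c2 else 0
      else
        bif e then bif nn then bif s then 0 else x.c1 else 0
        else bif nn then bif s then x.b2 else 0 else bif s then 0 else x.a2 := by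
  cases w <;> cases e <;> cases nn <;> cases s <;> rfl

set_option maxHeartbeats 2000000 in
/-- The free-fermionic six-vertex weights satisfy the Yang-Baxter equation. The weights of
the two rows need not be related to each other. -/
theorem yangBaxter_weight {x y : VertexWeights R} (hx : x.IsNormal) (hy : y.IsNormal) :
    YangBaxter (crossWeight x y) x.weight y.weight y.weight x.weight := by
  rcases x with ⟨a1, a2, b1, b2, c1, c2⟩
  rcases y with ⟨a1', a2', b1', b2', c1', c2'⟩
  obtain ⟨rfl, rfl⟩ : c1 = a1 * a2 + b1 * b2 ∧ c2 = 1 := hx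
  obtain ⟨rfl, rfl⟩ : c1' = a1' * a2' + b1' * b2' ∧ c2' = 1 := hy
  intro a b c d u v
  cases a <;> cases b <;> cases c <;> cases d <;> cases u <;> cases v <;>
    simp only [Fintype.sum_bool, VertexWeights.weight_eq, crossWeight, cond_true,
      cond_false, Bool.and_true, Bool.and_false, Bool.or_true, Bool.or_false, mul_zero, zero_mul,
      add_zero, zero_add, mul_one, one_mul] <;> ring

/-- A crossing passes through the prolonged half column without interaction. -/
theorem yangBaxter_crossing (B : Bool → Bool → Bool → Bool → R) (x y x' y' : VertexWeights R)
    (cR cL : R) (t : Bool) :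
    YangBaxter B (cellFun x cR cL t .crossing) (cellFun y cR cL t .crossing)
      (cellFun x' cR cL t .crossing) (cellFun y' cR cL t .crossing) := by
  intro a b c d u v
  cases a <;> cases b <;> cases c <;> cases d <;> cases u <;> cases v <;> cases t <;>
    simp [cellFun]

/-- The weight of a bend as a function of its two ends. -/
def bendWeight (D U : R) (x y : Bool) : R := if x = y then 0 else if x = true then D else U

/-- Two nested bends with a crossing above and a crossing below absorb both crossings, up to a
factor. -/
theorem nested_bends_relation {x y : VertexWeights R} (hx : x.IsNormal) (hy : y.IsNormal) (D U : R)
    (a b c d : Bool) :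
    ∑ a', ∑ b', crossWeight x y a b a' b' * ∑ c', ∑ d', crossWeight y.bar x.bar c d c' d' *
        (bendWeight D U a' d' * bendWeight D U b' c') =
      (y.a1 * x.a2 + x.b1 * y.b2) * (x.a1 * y.a2 + y.b1 * x.b2) *
        (bendWeight D U a d * bendWeight D U b c) := by
  rcases x with ⟨a1, a2, b1, b2, c1, c2⟩
  rcases y with ⟨a1', a2', b1', b2', c1', c2'⟩
  obtain ⟨rfl, rfl⟩ : c1 = a1 * a2 + b1 * b2 ∧ c2 = 1 := hx
  obtain ⟨rfl, rfl⟩ : c1' = a1' * a2' + b1' * b2' ∧ c2' = 1 := hy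
  cases a <;> cases b <;> cases c <;> cases d <;>
    simp only [Fintype.sum_bool, crossWeight, bendWeight, VertexWeights.bar, if_true,
      reduceCtorEq, if_false, cond_true, cond_false, Bool.and_true, Bool.and_false, Bool.or_true,
      Bool.or_false] <;> ring

/-- The fish relation for a bend with `D = i`. -/
theorem bend_relation_i {x : VertexWeights R} (hx : x.IsNormal) {i : R} (hi : i * i = -1)
    (a b : Bool) :
    ∑ a', ∑ b', crossWeight x x.bar a b a' b' * bendWeight i 1 a' b' =
      (x.a2 - i * x.b1) * (x.a1 + i * x.b2) * bendWeight i 1 a b := by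
  rcases x with ⟨a1, a2, b1, b2, c1, c2⟩
  obtain ⟨rfl, rfl⟩ : c1 = a1 * a2 + b1 * b2 ∧ c2 = 1 := hx
  cases a <;> cases b <;>
    simp only [Fintype.sum_bool, crossWeight, bendWeight, VertexWeights.bar, if_true,
      reduceCtorEq, if_false, cond_true, cond_false, Bool.and_true, Bool.and_false, Bool.or_true,
      Bool.or_false] <;> grind

/-- The part of a transfer operator that belongs to two adjacent rows, applied to a function `g` of
the two edges on the right; `u` and `v` are the vertical edges above and below the two rows. -/
def local₂ (W₁ W₂ : Bool → Bool → Bool → Bool → R) (g : Bool → Bool → R) (u v a b : Bool) : R :=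
  ∑ a', ∑ b', ∑ m, W₁ a a' u m * W₂ b b' m v * g a' b'

/-- The analogue of `local₂` for three consecutive rows. -/
def local₃ (W₁ W₂ W₃ : Bool → Bool → Bool → Bool → R) (g : Bool → Bool → Bool → R)
    (u v a b c : Bool) : R :=
  ∑ a', ∑ b', ∑ c', ∑ m, ∑ m', W₁ a a' u m * W₂ b b' m m' * W₃ c c' m' v * g a' b' c'

/-- The fish relation in the presence of a half column. -/
theorem half_bend_relation {x : VertexWeights R} (hx : x.IsNormal) (cR cL : R) (t u v a b : Bool) :
    ∑ a', ∑ b', crossWeight x x.bar a b a' b' *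
        local₂ (cellFun x.bar cR cL t .crossing) (cellFun x cR cL t .vertex) (bendWeight 1 1)
          u v a' b' =
      (if t = true then x.a1 ^ 2 + x.b2 ^ 2 else x.a2 ^ 2 + x.b1 ^ 2) *
        local₂ (cellFun x cR cL t .crossing) (cellFun x.bar cR cL t .vertex) (bendWeight 1 1)
          u v a b := by
  rcases x with ⟨a1, a2, b1, b2, c1, c2⟩
  obtain ⟨rfl, rfl⟩ : c1 = a1 * a2 + b1 * b2 ∧ c2 = 1 := hx
  cases a <;> cases b <;> cases t <;> cases u <;> cases v <;>
    simp [local₂, crossWeight, bendWeight, VertexWeights.bar, cellFun,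
      VertexWeights.weight_eq] <;> ring

/-- The composition of the three crossings that reverse the order of three strands. -/
def braid₃ (B₁ B₂ B₃ : Bool → Bool → Bool → Bool → R) (L : Bool → Bool → Bool → R)
    (a b c : Bool) : R :=
  ∑ x, ∑ y, B₁ a b x y * ∑ y', ∑ z, B₂ y c y' z * ∑ x', ∑ y'', B₃ x y' x' y'' * L x' y'' z

/-- A bend together with a central row whose right edge points outward absorbs the three crossings
that reverse the order of the three rows. -/
theorem bend_relation_outward {x z : VertexWeights R} {a0 b0 c0 : R} (hx : x.IsNormal)
    (hz : z = ⟨a0, a0, b0, b0, c0, 1⟩) (hz' : z.IsNormal) (a b c : Bool) :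
    braid₃ (crossWeight x z) (crossWeight x x.bar) (crossWeight z x.bar)
      (fun a b c => bendWeight 1 1 a c * if b = true then 1 else 0) a b c =
    (a0 * x.a2 + x.b1 * b0) * (a0 * x.a1 + x.b2 * b0) * (x.a2 ^ 2 + x.b1 ^ 2) *
      (bendWeight 1 1 a c * if b = true then 1 else 0) := by
  subst hz
  rcases x with ⟨a1, a2, b1, b2, c1, c2⟩
  obtain ⟨rfl, rfl⟩ : c1 = a1 * a2 + b1 * b2 ∧ c2 = 1 := hx
  obtain ⟨rfl, -⟩ : c0 = a0 * a0 + b0 * b0 ∧ _ := hz'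
  cases a <;> cases b <;> cases c <;>
    simp [braid₃, crossWeight, bendWeight, VertexWeights.bar] <;> ring

/-- The analogue of `bend_relation_outward` for a central row whose right edge points inward. -/
theorem bend_relation_inward {x z : VertexWeights R} {a0 b0 c0 : R} (hx : x.IsNormal)
    (hz : z = ⟨a0, a0, b0, b0, c0, 1⟩) (hz' : z.IsNormal) (a b c : Bool) :
    braid₃ (crossWeight x z) (crossWeight x x.bar) (crossWeight z x.bar)
      (fun a b c => bendWeight 1 1 a c * if b = false then 1 else 0) a b c =
    (a0 * x.a2 + x.b1 * b0) * (a0 * x.a1 + x.b2 * b0) * (x.a1 ^ 2 + x.b2 ^ 2) *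
      (bendWeight 1 1 a c * if b = false then 1 else 0) := by
  subst hz
  rcases x with ⟨a1, a2, b1, b2, c1, c2⟩
  obtain ⟨rfl, rfl⟩ : c1 = a1 * a2 + b1 * b2 ∧ c2 = 1 := hx
  obtain ⟨rfl, -⟩ : c0 = a0 * a0 + b0 * b0 ∧ _ := hz'
  cases a <;> cases b <;> cases c <;>
    simp [braid₃, crossWeight, bendWeight, VertexWeights.bar] <;> ring

/-- In type `C` the innermost bend, the corner and the topmost vertex of the half column together
act as a single vertex with weights `y`, up to a factor that depends on the orientations of the
upper two rows. -/
theorem local₃_corner_bend (x y z : VertexWeights R) (i cL : R) (t u v a b c : Bool) :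
    local₃ (cellFun x 1 cL t .crossing) (cellFun z 1 cL t .corner) (cellFun y 1 cL t .vertex)
        (fun a b c => bendWeight i 1 a c * if b = true then 1 else 0) u v a b c =
      if u = t then y.weight c (!a) b v * ((if b = true then 1 else cL) * if a = true then i else 1)
      else 0 := by
  cases a <;> cases b <;> cases t <;> cases u <;>
    simp [local₃, cellFun, bendWeight] <;> ring

/-- The analogue of `bend_relation_outward` in type `C`, where the central row turns down into the
half column. This is where the corner weight `a - i b` is needed. -/
theorem corner_bend_relation {x z : VertexWeights R} {a0 b0 c0 i : R} (hx : x.IsNormal)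
    (hz : z = ⟨a0, a0, b0, b0, c0, 1⟩) (hz' : z.IsNormal) (hi : i * i = -1) (t u v a b c : Bool) :
    braid₃ (crossWeight x z) (crossWeight x x.bar) (crossWeight z x.bar)
      (local₃ (cellFun x.bar 1 (a0 - i * b0) t .crossing) (cellFun z 1 (a0 - i * b0) t .corner)
        (cellFun x 1 (a0 - i * b0) t .vertex)
        (fun a b c => bendWeight i 1 a c * if b = true then 1 else 0) u v) a b c =
    (a0 * x.a2 + x.b1 * b0) * (a0 * x.a1 + x.b2 * b0) *
      ((x.a2 - i * x.b1) * (x.a1 + i * x.b2)) *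
      local₃ (cellFun x 1 (a0 - i * b0) t .crossing) (cellFun z 1 (a0 - i * b0) t .corner)
        (cellFun x.bar 1 (a0 - i * b0) t .vertex)
        (fun a b c => bendWeight i 1 a c * if b = true then 1 else 0) u v a b c := by
  subst hz
  rcases x with ⟨a1, a2, b1, b2, c1, c2⟩
  obtain ⟨rfl, rfl⟩ : c1 = a1 * a2 + b1 * b2 ∧ c2 = 1 := hx
  obtain ⟨rfl, -⟩ : c0 = a0 * a0 + b0 * b0 ∧ _ := hz'
  unfold braid₃
  simp only [local₃_corner_bend]
  by_cases hu : u = t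
  on_goal 2 => simp [hu]
  simp only [if_pos hu]
  cases v <;> cases a <;> cases b <;> cases c <;>
    simp [crossWeight, VertexWeights.bar, VertexWeights.weight_eq] <;> grind

end YangBaxter

/-! ### Boundary functions that are local to a few rows -/

section Local

variable {R : Type*} [CommRing R] {ι : Type*} [DecidableEq ι] {N : ℕ}

theorem sum_eq_sum_filter_update₂ {κ : Type*} [Fintype κ] [DecidableEq κ] {k l : κ} (hkl : k ≠ l)
    (F : (κ → Bool) → R) :
    ∑ v, F v = ∑ v with v k = true ∧ v l = true, ∑ a, ∑ b, F (update (update v k a) l b) := by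
  rw [sum_eq_sum_filter_update l, Finset.sum_filter, sum_eq_sum_filter_update k,
    ← Finset.filter_filter, Finset.sum_filter (s := Finset.filter _ _)]
  refine Finset.sum_congr rfl fun v _ => ?_
  simp only [update_of_ne hkl.symm]
  split_ifs <;> simp

theorem sum_eq_sum_filter_update₃ {κ : Type*} [Fintype κ] [DecidableEq κ] {k l m : κ} (hkl : k ≠ l)
    (hkm : k ≠ m) (hlm : l ≠ m) (F : (κ → Bool) → R) :
    ∑ v, F v = ∑ v with (v k = true ∧ v l = true) ∧ v m = true,
      ∑ a, ∑ b, ∑ c, F (update (update (update v k a) l b) m c) := by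
  rw [sum_eq_sum_filter_update m, Finset.sum_filter, sum_eq_sum_filter_update₂ hkl,
    Finset.sum_filter, Finset.sum_filter]
  refine Finset.sum_congr rfl fun v _ => ?_
  simp only [update_of_ne hkm.symm, update_of_ne hlm.symm, ite_and]
  split_ifs <;> simp

/-- The function `P` does not depend on the edge in row `r`. -/
def FreeOf (P : (ι → Bool) → R) (r : ι) : Prop := ∀ τ a, P (update τ r a) = P τ

theorem braid_mul_local {r s : ι} (hne : r ≠ s) (B : Bool → Bool → Bool → Bool → R)
    {P : (ι → Bool) → R} (hr : FreeOf P r) (hs : FreeOf P s) (g : Bool → Bool → R) :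
    braid r s B (fun τ => P τ * g (τ r) (τ s)) =
      fun σ => P σ * ∑ a, ∑ b, B (σ r) (σ s) a b * g a b := by
  funext σ
  simp only [braid, hr _ _, hs _ _, update_self, update_of_ne hne, Finset.mul_sum]
  exact Finset.sum_congr rfl fun _ _ => Finset.sum_congr rfl fun _ _ => by ring

theorem braid_sum {r s : ι} (B : Bool → Bool → Bool → Bool → R) {κ : Type*} (A : Finset κ)
    (f : κ → (ι → Bool) → R) :
    braid r s B (fun σ => ∑ k ∈ A, f k σ) = fun σ => ∑ k ∈ A, braid r s B (f k) σ := by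
  funext σ
  simp only [braid, Finset.mul_sum]
  rw [Finset.sum_comm]
  simp_rw [Finset.sum_comm (s := A)]
  rw [Finset.sum_comm]

/-- Three crossings that reverse the order of the rows `r`, `c`, `s`, acting on a function that is
local to these rows up to a factor that does not involve them. -/
theorem braid_braid_braid_mul_local {r c s : ι} (hrc : r ≠ c) (hrs : r ≠ s) (hcs : c ≠ s)
    (B₁ B₂ B₃ : Bool → Bool → Bool → Bool → R) {P : (ι → Bool) → R} (hr : FreeOf P r)
    (hc : FreeOf P c) (hs : FreeOf P s) (g : Bool → Bool → Bool → R) :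
    braid r c B₁ (braid c s B₂ (braid r c B₃ fun τ => P τ * g (τ r) (τ c) (τ s))) =
      fun σ => P σ * braid₃ B₁ B₂ B₃ g (σ r) (σ c) (σ s) := by
  have h1 : ∀ (B : Bool → Bool → Bool → Bool → R) (g : Bool → Bool → Bool → R),
      braid r c B (fun τ => P τ * g (τ r) (τ c) (τ s)) =
        fun σ => P σ * ∑ a, ∑ b, B (σ r) (σ c) a b * g a b (σ s) := by
    intro B g
    funext σ
    simp only [braid, hr _ _, hc _ _, update_self, update_of_ne hrc, update_of_ne hrs.symm,
      update_of_ne hcs.symm, Finset.mul_sum]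
    exact Finset.sum_congr rfl fun _ _ => Finset.sum_congr rfl fun _ _ => by ring
  have h2 : ∀ (B : Bool → Bool → Bool → Bool → R) (g : Bool → Bool → Bool → R),
      braid c s B (fun τ => P τ * g (τ r) (τ c) (τ s)) =
        fun σ => P σ * ∑ a, ∑ b, B (σ c) (σ s) a b * g (σ r) a b := by
    intro B g
    funext σ
    simp only [braid, hc _ _, hs _ _, update_self, update_of_ne hrc, update_of_ne hrs,
      update_of_ne hcs, Finset.mul_sum]
    exact Finset.sum_congr rfl fun _ _ => Finset.sum_congr rfl fun _ _ => by ring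
  rw [h1 B₃ g, h2 B₂ fun x y z => ∑ a, ∑ b, B₃ x y a b * g a b z,
    h1 B₁ fun x y z => ∑ a, ∑ b, B₂ y z a b * ∑ a', ∑ b', B₃ x a a' b' * g a' b' b]
  rfl

variable [Fintype ι]

/-- A column acting on a function that depends on the rows `r` and `s` through a factor `g`: the
summation over the inner edges of these two rows is carried out separately, giving `local₂`. -/
theorem colOp_eq_sum_local₂ {lev : ι → Fin N} (hlev : Injective lev) {r s : ι}
    (hrs : (lev r).succ = (lev s).castSucc) (W : ι → Bool → Bool → Bool → Bool → R) (t : Bool)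
    {P : (ι → Bool) → R} (hr : FreeOf P r) (hs : FreeOf P s)
    (g : Bool → Bool → R) (σ : ι → Bool) :
    colOp lev W t (fun τ => P τ * g (τ r) (τ s)) σ =
      ∑ v : Fin (N + 1) → Bool with v (lev r).succ = true,
      ∑ τ : ι → Bool with τ r = true ∧ τ s = true,
        (if v 0 = t ∧ v (Fin.last N) = true then 1 else 0) *
          (∏ q ∈ (Finset.univ.erase r).erase s, W q (σ q) (τ q) (v (lev q).castSucc)
            (v (lev q).succ)) * P τ *
          local₂ (W r) (W s) g (v (lev r).castSucc) (v (lev s).succ) (σ r) (σ s) := by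
  have hne : r ≠ s := by
    rintro rfl
    exact absurd (congrArg Fin.val hrs) (by simp)
  have h0 : (0 : Fin (N + 1)) ≠ (lev r).succ := (Fin.succ_ne_zero _).symm
  have h1 : Fin.last N ≠ (lev r).succ := hrs ▸ (Fin.castSucc_lt_last _).ne'
  have h2 : (lev r).castSucc ≠ (lev r).succ := Fin.castSucc_lt_succ.ne
  have h3 : (lev s).succ ≠ (lev r).succ := hrs ▸ Fin.castSucc_lt_succ.ne'
  rw [colOp, sum_eq_sum_filter_update (lev r).succ]
  refine Finset.sum_congr rfl fun v _ => ?_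
  rw [Finset.sum_comm, sum_eq_sum_filter_update₂ hne]
  refine Finset.sum_congr rfl fun τ _ => ?_
  simp only [local₂, Finset.mul_sum]
  refine Finset.sum_congr rfl fun a _ => Finset.sum_congr rfl fun b _ =>
    Finset.sum_congr rfl fun m _ => ?_
  rw [prod_eq_mul_mul_prod hne, hs, hr]
  simp only [update_of_ne h0, update_of_ne h1, update_of_ne h2, update_of_ne h3, update_self,
    ← hrs, update_of_ne hne]
  rw [Finset.prod_congr rfl (g := fun q => W q (σ q) (τ q) (v (lev q).castSucc) (v (lev q).succ))]
  · ring
  · intro q hq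
    simp only [Finset.mem_erase, Finset.mem_univ, and_true] at hq
    have h4 : (lev q).castSucc ≠ (lev r).succ := fun h =>
      hq.1 (hlev (Fin.castSucc_injective _ (h.trans hrs)))
    have h5 : (lev q).succ ≠ (lev r).succ := fun h => hq.2 (hlev (Fin.succ_injective _ h))
    simp only [update_of_ne h4, update_of_ne h5, update_of_ne hq.1, update_of_ne hq.2]

/-- The analogue of `colOp_eq_sum_local₂` for three consecutive rows. -/
theorem colOp_eq_sum_local₃ {lev : ι → Fin N} (hlev : Injective lev) {r c s : ι}
    (hrc : (lev r).succ = (lev c).castSucc) (hcs : (lev c).succ = (lev s).castSucc)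
    (W : ι → Bool → Bool → Bool → Bool → R) (t : Bool)
    {P : (ι → Bool) → R} (hr : FreeOf P r) (hc : FreeOf P c) (hs : FreeOf P s)
    (g : Bool → Bool → Bool → R) (σ : ι → Bool) :
    colOp lev W t (fun τ => P τ * g (τ r) (τ c) (τ s)) σ =
      ∑ v : Fin (N + 1) → Bool with v (lev r).succ = true ∧ v (lev c).succ = true,
      ∑ τ : ι → Bool with (τ r = true ∧ τ c = true) ∧ τ s = true,
        (if v 0 = t ∧ v (Fin.last N) = true then 1 else 0) *
          (∏ q ∈ ((Finset.univ.erase r).erase c).erase s, W q (σ q) (τ q) (v (lev q).castSucc)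
            (v (lev q).succ)) * P τ *
          local₃ (W r) (W c) (W s) g (v (lev r).castSucc) (v (lev s).succ) (σ r) (σ c) (σ s) := by
  have hrc' := congrArg Fin.val hrc
  have hcs' := congrArg Fin.val hcs
  simp only [Fin.val_succ, Fin.val_castSucc] at hrc' hcs'
  have hne : r ≠ c := by rintro rfl; omega
  have hne' : r ≠ s := by rintro rfl; omega
  have hne'' : c ≠ s := by rintro rfl; omega
  have hk : (lev r).succ ≠ (lev c).succ := fun h => hne (hlev (Fin.succ_injective _ h))
  have h1 : (0 : Fin (N + 1)) ≠ (lev r).succ := (Fin.succ_ne_zero _).symm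
  have h2 : (0 : Fin (N + 1)) ≠ (lev c).succ := (Fin.succ_ne_zero _).symm
  have h3 : Fin.last N ≠ (lev r).succ := hrc ▸ (Fin.castSucc_lt_last _).ne'
  have h4 : Fin.last N ≠ (lev c).succ := hcs ▸ (Fin.castSucc_lt_last _).ne'
  have h5 : (lev r).castSucc ≠ (lev r).succ := Fin.castSucc_lt_succ.ne
  have h6 : (lev r).castSucc ≠ (lev c).succ := fun h => by
    have := congrArg Fin.val h; simp only [Fin.val_succ, Fin.val_castSucc] at this; omega
  have h7 : (lev s).succ ≠ (lev r).succ := fun h => hne' (hlev (Fin.succ_injective _ h.symm))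
  have h8 : (lev s).succ ≠ (lev c).succ := fun h => hne'' (hlev (Fin.succ_injective _ h.symm))
  rw [colOp, sum_eq_sum_filter_update₂ hk]
  refine Finset.sum_congr rfl fun v _ => ?_
  have hsum : ∀ X : Bool → Bool → (ι → Bool) → R,
      ∑ a, ∑ b, ∑ τ, X a b τ = ∑ τ, ∑ a, ∑ b, X a b τ := by
    intro X
    simp only [Finset.sum_comm (s := (Finset.univ : Finset Bool)) (t := (Finset.univ :
      Finset (ι → Bool)))]
  rw [hsum, sum_eq_sum_filter_update₃ hne hne' hne'']
  refine Finset.sum_congr rfl fun τ _ => ?_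
  simp only [local₃, Finset.mul_sum]
  refine Finset.sum_congr rfl fun a _ => Finset.sum_congr rfl fun b _ =>
    Finset.sum_congr rfl fun d _ => Finset.sum_congr rfl fun m _ =>
    Finset.sum_congr rfl fun m' _ => ?_
  rw [prod_eq_mul_mul_prod hne,
    ← Finset.mul_prod_erase ((Finset.univ.erase r).erase c) _ (a := s)
      (by simp [hne'.symm, hne''.symm]),
    hs, hc, hr]
  simp only [update_of_ne h1, update_of_ne h2, update_of_ne h3, update_of_ne h4, update_of_ne h5,
    update_of_ne h6, update_of_ne h7, update_of_ne h8, update_self, ← hrc, ← hcs,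
    update_of_ne hne, update_of_ne hne', update_of_ne hne'', update_of_ne hk]
  rw [Finset.prod_congr rfl (g := fun q => W q (σ q) (τ q) (v (lev q).castSucc) (v (lev q).succ))]
  · ring
  · intro q hq
    simp only [Finset.mem_erase, Finset.mem_univ, and_true] at hq
    obtain ⟨hqs, hqc, hqr⟩ := hq
    have h9 : (lev q).castSucc ≠ (lev r).succ := fun h =>
      hqc (hlev (Fin.castSucc_injective _ (h.trans hrc)))
    have h10 : (lev q).succ ≠ (lev r).succ := fun h => hqr (hlev (Fin.succ_injective _ h))
    have h11 : (lev q).castSucc ≠ (lev c).succ := fun h =>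
      hqs (hlev (Fin.castSucc_injective _ (h.trans hcs)))
    have h12 : (lev q).succ ≠ (lev c).succ := fun h => hqc (hlev (Fin.succ_injective _ h))
    simp only [update_of_ne h9, update_of_ne h10, update_of_ne h11, update_of_ne h12,
      update_of_ne hqs, update_of_ne hqc, update_of_ne hqr]

/-- A fish relation for a function that is local to two adjacent rows and passes through a column
whose weights differ before and after the crossing. -/
theorem braid_colOp_local₂ {lev : ι → Fin N} (hlev : Injective lev) {r s : ι}
    (hrs : (lev r).succ = (lev s).castSucc) {W W' : ι → Bool → Bool → Bool → Bool → R}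
    (hW : ∀ q, q ≠ r → q ≠ s → W q = W' q) (t : Bool)
    {P : (ι → Bool) → R} (hr : FreeOf P r) (hs : FreeOf P s) (g : Bool → Bool → R)
    (B : Bool → Bool → Bool → Bool → R) (κ : R)
    (h : ∀ u v a b, ∑ a', ∑ b', B a b a' b' * local₂ (W' r) (W' s) g u v a' b' =
      κ * local₂ (W r) (W s) g u v a b) :
    braid r s B (colOp lev W' t fun τ => P τ * g (τ r) (τ s)) =
      fun σ => κ * colOp lev W t (fun τ => P τ * g (τ r) (τ s)) σ := by
  have hne : r ≠ s := by
    rintro rfl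
    exact absurd (congrArg Fin.val hrs) (by simp)
  rw [funext (colOp_eq_sum_local₂ hlev hrs W' t hr hs g), braid_sum]
  simp only [braid_sum, colOp_eq_sum_local₂ hlev hrs W t hr hs g, Finset.mul_sum]
  funext σ
  refine Finset.sum_congr rfl fun v _ => Finset.sum_congr rfl fun τ _ => ?_
  rw [braid_mul_local hne B (P := fun σ => (if v 0 = t ∧ v (Fin.last N) = true then 1 else 0) *
          (∏ q ∈ (Finset.univ.erase r).erase s, W' q (σ q) (τ q) (v (lev q).castSucc)
            (v (lev q).succ)) * P τ) ?_ ?_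
    (local₂ (W' r) (W' s) g (v (lev r).castSucc) (v (lev s).succ))]
  · simp only [h]
    rw [Finset.prod_congr rfl fun q hq => by
      simp only [Finset.mem_erase, Finset.mem_univ, and_true] at hq
      rw [← hW q hq.2 hq.1]]
    ring
  all_goals
    intro τ a
    simp only
    congr 2
    refine Finset.prod_congr rfl fun q hq => ?_
    simp only [Finset.mem_erase, Finset.mem_univ, and_true] at hq
  · rw [update_of_ne hq.2]
  · rw [update_of_ne hq.1]

/-- The analogue of `braid_colOp_local₂` for three consecutive rows. -/
theorem braid_colOp_local₃ {lev : ι → Fin N} (hlev : Injective lev) {r c s : ι}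
    (hrc : (lev r).succ = (lev c).castSucc) (hcs : (lev c).succ = (lev s).castSucc)
    {W W' : ι → Bool → Bool → Bool → Bool → R}
    (hW : ∀ q, q ≠ r → q ≠ c → q ≠ s → W q = W' q) (t : Bool)
    {P : (ι → Bool) → R} (hr : FreeOf P r) (hc : FreeOf P c) (hs : FreeOf P s)
    (g : Bool → Bool → Bool → R) (B₁ B₂ B₃ : Bool → Bool → Bool → Bool → R) (κ : R)
    (h : ∀ u v a b d, braid₃ B₁ B₂ B₃ (local₃ (W' r) (W' c) (W' s) g u v) a b d =
      κ * local₃ (W r) (W c) (W s) g u v a b d) :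
    braid r c B₁ (braid c s B₂ (braid r c B₃
      (colOp lev W' t fun τ => P τ * g (τ r) (τ c) (τ s)))) =
      fun σ => κ * colOp lev W t (fun τ => P τ * g (τ r) (τ c) (τ s)) σ := by
  have hrc' := congrArg Fin.val hrc
  have hcs' := congrArg Fin.val hcs
  simp only [Fin.val_succ, Fin.val_castSucc] at hrc' hcs'
  have hne : r ≠ c := by rintro rfl; omega
  have hne' : r ≠ s := by rintro rfl; omega
  have hne'' : c ≠ s := by rintro rfl; omega
  rw [funext (colOp_eq_sum_local₃ hlev hrc hcs W' t hr hc hs g)]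
  simp only [braid_sum, colOp_eq_sum_local₃ hlev hrc hcs W t hr hc hs g, Finset.mul_sum]
  funext σ
  refine Finset.sum_congr rfl fun v _ => Finset.sum_congr rfl fun τ _ => ?_
  rw [braid_braid_braid_mul_local hne hne' hne'' B₁ B₂ B₃
    (P := fun σ => (if v 0 = t ∧ v (Fin.last N) = true then 1 else 0) *
          (∏ q ∈ ((Finset.univ.erase r).erase c).erase s, W' q (σ q) (τ q) (v (lev q).castSucc)
            (v (lev q).succ)) * P τ) ?_ ?_ ?_
    (local₃ (W' r) (W' c) (W' s) g (v (lev r).castSucc) (v (lev s).succ))]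
  · simp only [h]
    rw [Finset.prod_congr rfl fun q hq => by
      simp only [Finset.mem_erase, Finset.mem_univ, and_true] at hq
      rw [← hW q hq.2.2 hq.2.1 hq.1]]
    ring
  all_goals
    intro τ a
    simp only
    congr 2
    refine Finset.prod_congr rfl fun q hq => ?_
    simp only [Finset.mem_erase, Finset.mem_univ, and_true] at hq
  · rw [update_of_ne hq.2.2]
  · rw [update_of_ne hq.2.1]
  · rw [update_of_ne hq.1]

end Local

end IceModel

namespace IceModel

open Function Equiv

/-! ### Exchange of neighbouring spectral indices -/

section Exchange

variable {R : Type*} {M : IceModel} {n : ℕ}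

/-- Exchanging two spectral indices exchanges two pairs of rows. -/
theorem rowWeights_swap (w : Weights (M.bends n) R) (j k : Fin (M.bends n)) :
    rowWeights (M := M) (n := n) { w with row := w.row ∘ swap j k } =
      (rowWeights w ∘ swap (.inl j) (.inl k)) ∘ swap (.inr (.inr k)) (.inr (.inr j)) := by
  funext r
  rcases r with i | c | i
  · simp only [comp_apply]
    rw [swap_apply_of_ne_of_ne (a := Sum.inr (Sum.inr k)) (by simp) (by simp)]
    simp only [swap_apply_def, Sum.inl.injEq]
    split_ifs <;> simp_all [rowWeights, swap_apply_def]
  · simp only [comp_apply]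
    rw [swap_apply_of_ne_of_ne (a := Sum.inr (Sum.inr k)) (by simp) (by simp),
      swap_apply_of_ne_of_ne (a := Sum.inl j) (by simp) (by simp)]
    rfl
  · simp only [comp_apply]
    simp only [swap_apply_def, Sum.inr.injEq]
    split_ifs <;> simp_all [rowWeights, swap_apply_def]

variable [CommRing R]

/-- A crossing passes through a column and exchanges the weights of the two rows concerned. -/
theorem column_braid {l p : ℕ} {ρ : M.Row n → VertexWeights R} (hρ : ∀ r, (ρ r).IsNormal)
    (cR cL : R) (t : ℕ → Bool) {r s : M.Row n} (hrs : (level r).succ = (level s).castSucc)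
    (hcell : cellAt l r p = cellAt l s p) (hcorner : cellAt l r p ≠ .corner)
    (f : (M.Row n → Bool) → R) :
    column l ρ cR cL t p (braid r s (crossWeight (ρ r) (ρ s)) f) =
      braid r s (crossWeight (ρ r) (ρ s)) (column l (ρ ∘ swap r s) cR cL t p f) := by
  refine colOp_braid level_injective hrs (fun q hqr hqs => ?_) ?_ _ f
  · rw [comp_apply, swap_apply_of_ne_of_ne hqr hqs]
  · simp only [comp_apply, swap_apply_left, swap_apply_right]
    rw [← hcell]
    rcases hc : cellAt l r p with _ | _ | _
    · exact yangBaxter_weight (hρ r) (hρ s)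
    · exact yangBaxter_crossing _ _ _ _ _ _ _ _
    · exact absurd hc hcorner

/-- Attaching a crossing at the left boundary, where all edges point inward, and moving it to the
right through `c` columns. -/
theorem transfer_column_swap {l c : ℕ} {ρ : M.Row n → VertexWeights R} (hρ : ∀ r, (ρ r).IsNormal)
    (cR cL : R) (t : ℕ → Bool) {r s : M.Row n} (hrs : (level r).succ = (level s).castSucc)
    (hcell : ∀ p < c, cellAt l r p = cellAt l s p ∧ cellAt l r p ≠ .corner)
    (f : (M.Row n → Bool) → R) :
    ((ρ r).b1 * (ρ s).b2 + (ρ r).a2 * (ρ s).a1) *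
        transfer (column l (ρ ∘ swap r s) cR cL t) c f (fun _ => true) =
      transfer (column l ρ cR cL t) c (braid r s (crossWeight (ρ r) (ρ s)) f) (fun _ => true) := by
  rw [transfer_braid (T' := column l (ρ ∘ swap r s) cR cL t)
    (fun p hp f => column_braid hρ cR cL t hrs (hcell p hp).1 (hcell p hp).2 f), braid_top]
  · rfl
  · intro a b h
    cases a <;> cases b <;> simp_all [crossWeight]

/-- The weights are free-fermionic with all `c₂` equal to `1`. -/
def Weights.IsNormal {m : ℕ} (w : Weights m R) : Prop :=
  (∀ j, (w.row j).IsNormal) ∧ w.c10 = w.a0 * w.a0 + w.b0 * w.b0 ∧ w.c20 = 1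

theorem Weights.IsNormal.rowWeights {w : Weights (M.bends n) R} (hw : w.IsNormal) (r : M.Row n) :
    (rowWeights w r).IsNormal := by
  rcases r with j | c | j
  · exact hw.1 j
  · exact hw.2
  · refine ⟨?_, (hw.1 j).2⟩
    have := (hw.1 j).1
    simp only [IceModel.rowWeights, VertexWeights.bar]
    rw [this]
    ring

/-- The contribution of all bends but `j`. -/
def otherBends (D U : R) (J : Finset (Fin (M.bends n))) (τ : M.Row n → Bool) : R :=
  ∏ i ∈ Jᶜ, bendWeight D U (τ (.inl i)) (τ (.inr (.inr i)))

theorem freeOf_otherBends_inl (D U : R) {J : Finset (Fin (M.bends n))} {j : Fin (M.bends n)}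
    (hj : j ∈ J) : FreeOf (otherBends (M := M) D U J) (.inl j) := by
  intro τ a
  refine Finset.prod_congr rfl fun i hi => ?_
  have hij : i ≠ j := by rintro rfl; exact Finset.mem_compl.1 hi hj
  rw [update_of_ne (by simpa using hij), update_of_ne (by simp)]

theorem freeOf_otherBends_inr (D U : R) {J : Finset (Fin (M.bends n))} {j : Fin (M.bends n)}
    (hj : j ∈ J) : FreeOf (otherBends (M := M) D U J) (.inr (.inr j)) := by
  intro τ a
  refine Finset.prod_congr rfl fun i hi => ?_
  have hij : i ≠ j := by rintro rfl; exact Finset.mem_compl.1 hi hj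
  rw [update_of_ne (by simp), update_of_ne (by simpa using hij)]

theorem freeOf_otherBends_central (D U : R) (J : Finset (Fin (M.bends n))) (c : Fin M.central) :
    FreeOf (otherBends (M := M) D U J) (.inr (.inl c)) := by
  intro τ a
  refine Finset.prod_congr rfl fun i hi => ?_
  rw [update_of_ne (by simp), update_of_ne (by simp)]

/-- The contribution of the right boundary of the central row. -/
def centralEnd (τ : M.Row n → Bool) : R :=
  ∏ c, if τ (.inr (.inl c)) = true ↔ M ≠ BC then 1 else 0

theorem freeOf_centralEnd_inl (j : Fin (M.bends n)) :
    FreeOf (centralEnd (R := R) (M := M)) (.inl j) := fun τ a =>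
  Finset.prod_congr rfl fun c _ => by rw [update_of_ne (by simp)]

theorem freeOf_centralEnd_inr (j : Fin (M.bends n)) :
    FreeOf (centralEnd (R := R) (M := M)) (.inr (.inr j)) := fun τ a =>
  Finset.prod_congr rfl fun c _ => by rw [update_of_ne (by simp)]

theorem FreeOf.mul {ι : Type*} [DecidableEq ι] {P Q : (ι → Bool) → R} {r : ι} (hP : FreeOf P r)
    (hQ : FreeOf Q r) : FreeOf (fun τ => P τ * Q τ) r := fun τ a => by
  simp only [hP τ a, hQ τ a]

/-- The weight of the right boundary, with the bends in `J` split off. -/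
theorem boundary_eq (d u : R) (J : Finset (Fin (M.bends n))) (τ : M.Row n → Bool) :
    boundary (fun _ => d) (fun _ => u) τ = otherBends d u J τ * centralEnd τ *
      ∏ j ∈ J, bendWeight d u (τ (.inl j)) (τ (.inr (.inr j))) := by
  rw [boundary, ← Finset.prod_mul_prod_compl J, otherBends, centralEnd]
  simp only [bendWeight]
  ring

theorem inl_succ_level {j k : Fin (M.bends n)} (hjk : (k : ℕ) = j + 1) :
    (level (.inl j : M.Row n)).succ = (level (.inl k : M.Row n)).castSucc :=
  Fin.ext hjk.symm

theorem inr_succ_level {j k : Fin (M.bends n)} (hjk : (k : ℕ) = j + 1) :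
    (level (.inr (.inr k) : M.Row n)).succ = (level (.inr (.inr j) : M.Row n)).castSucc := by
  have := k.isLt
  refine Fin.ext ?_
  simp only [level, Fin.val_succ, Fin.val_castSucc]
  omega

/-- Exchange of two neighbouring spectral indices. -/
theorem partitionFunction_swap [NeZero n] (lam : Fin n → ℕ) {w : Weights (M.bends n) R}
    (hw : w.IsNormal) {d u : R} (hD : w.D = fun _ => d) (hU : w.U = fun _ => u)
    {j k : Fin (M.bends n)} (hjk : (k : ℕ) = j + 1) :
    ((w.row k).a1 * (w.row j).a2 + (w.row j).b1 * (w.row k).b2) ^ 2 *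
        M.partitionFunction lam { w with row := w.row ∘ swap j k } =
      ((w.row k).a1 * (w.row j).a2 + (w.row j).b1 * (w.row k).b2) *
        ((w.row j).a1 * (w.row k).a2 + (w.row k).b1 * (w.row j).b2) *
        M.partitionFunction lam w := by
  have hne : j ≠ k := by rintro rfl; omega
  rw [partitionFunction_eq_transfer, partitionFunction_eq_transfer]
  simp only [rowWeights_swap]
  have hρ : ∀ r, ((rowWeights w ∘ swap (.inl j : M.Row n) (.inl k)) r).IsNormal := fun r =>
    hw.rowWeights _
  have hr3 : (rowWeights w ∘ swap (.inl j : M.Row n) (.inl k)) (.inr (.inr k)) =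
      (w.row k).bar := by
    rw [comp_apply, swap_apply_of_ne_of_ne (by simp) (by simp)]
    rfl
  have hr4 : (rowWeights w ∘ swap (.inl j : M.Row n) (.inl k)) (.inr (.inr j)) =
      (w.row j).bar := by
    rw [comp_apply, swap_apply_of_ne_of_ne (by simp) (by simp)]
    rfl
  have hcell₁ : ∀ p, cellAt (lam 0) (.inl j : M.Row n) p = cellAt (lam 0) (.inl k : M.Row n) p ∧
      cellAt (lam 0) (.inl j : M.Row n) p ≠ .corner := by
    intro p
    unfold cellAt
    split_ifs <;> simp [halfCell]
  have hcell₂ : ∀ p, cellAt (lam 0) (.inr (.inr k) : M.Row n) p =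
      cellAt (lam 0) (.inr (.inr j) : M.Row n) p ∧
      cellAt (lam 0) (.inr (.inr k) : M.Row n) p ≠ .corner := by
    intro p
    unfold cellAt
    split_ifs <;> simp [halfCell]
  -- The crossing of the lower rows is attached to the already exchanged upper rows.
  have h₂ := transfer_column_swap hρ w.cornerR w.cornerL (topEdge lam) (inr_succ_level hjk)
    (fun p (_ : p < M.cols (lam 0)) => hcell₂ p) (boundary w.D w.U)
  have h₁ := transfer_column_swap hw.rowWeights w.cornerR w.cornerL (topEdge lam)
    (inl_succ_level hjk) (fun p (_ : p < M.cols (lam 0)) => hcell₁ p)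
    (braid (.inr (.inr k)) (.inr (.inr j)) (crossWeight (w.row k).bar (w.row j).bar)
      (boundary w.D w.U))
  rw [hr3, hr4] at h₂
  rw [← h₂] at h₁
  have hclose : braid (.inl j) (.inl k) (crossWeight (rowWeights w (.inl j : M.Row n))
        (rowWeights w (.inl k : M.Row n)))
      (braid (.inr (.inr k)) (.inr (.inr j)) (crossWeight (w.row k).bar (w.row j).bar)
        (boundary w.D w.U)) = fun σ : M.Row n → Bool =>
      (((w.row k).a1 * (w.row j).a2 + (w.row j).b1 * (w.row k).b2) *
        ((w.row j).a1 * (w.row k).a2 + (w.row k).b1 * (w.row j).b2)) * boundary w.D w.U σ := by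
    funext σ
    rw [hD, hU]
    have hP : ∀ i ∈ ({j, k} : Finset _),
        FreeOf (fun τ : M.Row n → Bool => otherBends d u {j, k} τ * centralEnd τ) (.inl i) ∧
        FreeOf (fun τ : M.Row n → Bool => otherBends d u {j, k} τ * centralEnd τ)
          (.inr (.inr i)) := fun i hi =>
      ⟨(freeOf_otherBends_inl d u hi).mul (freeOf_centralEnd_inl i),
        (freeOf_otherBends_inr d u hi).mul (freeOf_centralEnd_inr i)⟩
    have hb : ∀ τ : M.Row n → Bool, boundary (fun _ => d) (fun _ => u) τ =
        (fun τ : M.Row n → Bool => otherBends d u {j, k} τ * centralEnd τ) τ *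
          (bendWeight d u (τ (.inl j)) (τ (.inr (.inr j))) *
            bendWeight d u (τ (.inl k)) (τ (.inr (.inr k)))) := fun τ => by
      rw [boundary_eq d u {j, k} τ, Finset.prod_pair hne]
    generalize (fun τ : M.Row n → Bool => otherBends d u {j, k} τ * centralEnd τ) = P at hP hb
    obtain ⟨hP1, hP4⟩ := hP j (by simp)
    obtain ⟨hP2, hP3⟩ := hP k (by simp)
    have h12 : (Sum.inl j : M.Row n) ≠ .inl k := by simpa using hne
    have h34 : (Sum.inr (Sum.inr k) : M.Row n) ≠ .inr (.inr j) := by simpa using hne.symm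
    have hlr : ∀ i i' : Fin (M.bends n), (Sum.inl i : M.Row n) ≠ .inr (.inr i') := by simp
    have hnest := nested_bends_relation (hw.1 j) (hw.1 k) d u (σ (.inl j)) (σ (.inl k))
      (σ (.inr (.inr k))) (σ (.inr (.inr j)))
    simp only [braid, hb, hP1 _ _, hP2 _ _, hP3 _ _, hP4 _ _, update_self, update_of_ne h12,
      update_of_ne h34, update_of_ne (hlr _ _), update_of_ne (hlr _ _).symm]
    rw [mul_left_comm, ← hnest]
    simp only [Finset.mul_sum]
    exact Finset.sum_congr rfl fun _ _ => Finset.sum_congr rfl fun _ _ =>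
      Finset.sum_congr rfl fun _ _ => Finset.sum_congr rfl fun _ _ => by
        simp only [rowWeights]; ring
  rw [hclose, transfer_smul (T := column _ _ _ _ _) fun p κ f => colOp_smul _ _ _ κ f] at h₁
  simp only [rowWeights, VertexWeights.bar] at h₁
  linear_combination h₁

end Exchange

/-! ### Inversion of the innermost spectral index -/

section Flip

variable {R : Type*} {M : IceModel} {n : ℕ}

theorem VertexWeights.bar_bar (x : VertexWeights R) : x.bar.bar = x := rfl

/-- Inverting a spectral index exchanges the two rows that its bend joins. -/
theorem rowWeights_flip (w : Weights (M.bends n) R) (j : Fin (M.bends n)) :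
    rowWeights (M := M) (n := n) { w with row := update w.row j (w.row j).bar } =
      rowWeights w ∘ swap (.inl j) (.inr (.inr j)) := by
  funext r
  rcases r with i | c | i
  · rw [comp_apply, swap_apply_def]
    simp only [Sum.inl.injEq, reduceCtorEq, if_false]
    split_ifs with h
    · subst h
      simp [rowWeights]
    · simp [rowWeights, update_of_ne h]
  · rw [comp_apply, swap_apply_of_ne_of_ne (by simp) (by simp)]
    rfl
  · rw [comp_apply, swap_apply_def]
    simp only [Sum.inr.injEq, reduceCtorEq, if_false]
    split_ifs with h
    · subst h
      simp [rowWeights, VertexWeights.bar_bar]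
    · simp [rowWeights, update_of_ne h]

variable [CommRing R]

/-- The factor of the deformed Weyl denominator that belongs to a single spectral index. -/
def rowFactor (M : IceModel) (lam : Fin n → ℕ) (i a0 b0 : R) (x : VertexWeights R) : R :=
  match M with
  | B => x.a2 + i * x.b1
  | Bstar => a0 * x.a2 + x.b1 * b0
  | C => (x.a2 + i * x.b1) * (a0 * x.a2 + x.b1 * b0)
  | Cstar => x.a2 ^ 2 + x.b1 ^ 2
  | D => if ∃ k, lam k = 1 then 1 else x.a2 ^ 2 + x.b1 ^ 2
  | BC => (a0 * x.a2 + x.b1 * b0) * (x.a2 ^ 2 + x.b1 ^ 2)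

/-- The factor of the deformed Weyl denominator that belongs to a pair of spectral indices. -/
def pairFactor (x y : VertexWeights R) : R :=
  (y.a1 * x.a2 + x.b1 * y.b2) * (x.a2 * y.a2 + y.b1 * x.b1)

theorem denominator_eq {m : ℕ} (lam : Fin n → ℕ) (i : R) (w : Weights m R) :
    M.denominator lam i w = (∏ j, rowFactor M lam i w.a0 w.b0 (w.row j)) *
      ∏ j, ∏ k ∈ Finset.Ioi j, pairFactor (w.row j) (w.row k) := by
  cases M <;> rfl

theorem inl_succ_level_inr (hM : M.central = 0) {j : Fin (M.bends n)}
    (hj : (j : ℕ) + 1 = M.bends n) :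
    (level (.inl j : M.Row n)).succ = (level (.inr (.inr j) : M.Row n)).castSucc := by
  refine Fin.ext ?_
  simp only [level, Fin.val_succ, Fin.val_castSucc]
  omega

theorem inl_succ_level_central (hM : M.central = 1) {j : Fin (M.bends n)}
    (hj : (j : ℕ) + 1 = M.bends n) (c : Fin M.central) :
    (level (.inl j : M.Row n)).succ = (level (.inr (.inl c) : M.Row n)).castSucc := by
  refine Fin.ext ?_
  simp only [level, Fin.val_succ, Fin.val_castSucc]
  omega

theorem central_succ_level_inr (hM : M.central = 1) {j : Fin (M.bends n)}
    (hj : (j : ℕ) + 1 = M.bends n) (c : Fin M.central) :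
    (level (.inr (.inl c) : M.Row n)).succ = (level (.inr (.inr j) : M.Row n)).castSucc := by
  refine Fin.ext ?_
  simp only [level, Fin.val_succ, Fin.val_castSucc]
  omega

/-- Moving the crossing of the two innermost rows through the full columns if there is no central
row. -/
theorem transfer_column_flip (hM : M.central = 0) {l q : ℕ} {w : Weights (M.bends n) R}
    (hw : w.IsNormal) (t : ℕ → Bool) {j : Fin (M.bends n)} (hj : (j : ℕ) + 1 = M.bends n)
    (hq : ∀ p < q, ∀ r : M.Row n, cellAt l r p = .vertex) {f f' : (M.Row n → Bool) → R} {κ : R}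
    (hf : braid (.inl j) (.inr (.inr j)) (crossWeight (w.row j) (w.row j).bar) f' =
      fun σ => κ * f σ) :
    ((w.row j).a2 ^ 2 + (w.row j).b1 ^ 2) *
        transfer (column l (rowWeights w ∘ swap (.inl j) (.inr (.inr j))) w.cornerR w.cornerL t) q
          f' (fun _ => true) =
      κ * transfer (column l (rowWeights w) w.cornerR w.cornerL t) q f (fun _ => true) := by
  have h := transfer_column_swap (l := l) (c := q) hw.rowWeights w.cornerR w.cornerL t
    (inl_succ_level_inr hM hj)
    (fun p hp => by rw [hq p hp, hq p hp]; exact ⟨rfl, by simp⟩) f'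
  have hf' : braid (.inl j) (.inr (.inr j)) (crossWeight (rowWeights w (.inl j : M.Row n))
    (rowWeights w (.inr (.inr j) : M.Row n))) f' = fun σ => κ * f σ := hf
  rw [hf', transfer_smul (T := column _ _ _ _ _) fun p κ f => colOp_smul _ _ _ κ f] at h
  refine Eq.trans ?_ h
  simp only [rowWeights, VertexWeights.bar]
  ring

/-- Moving the three crossings of the two innermost rows and the central row through the full
columns. -/
theorem transfer_column_flip_central (hM : M.central = 1) {l q : ℕ} {w : Weights (M.bends n) R}
    (hw : w.IsNormal) (t : ℕ → Bool) {j : Fin (M.bends n)} (hj : (j : ℕ) + 1 = M.bends n)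
    (c : Fin M.central) (hq : ∀ p < q, ∀ r : M.Row n, cellAt l r p = .vertex)
    {f f' : (M.Row n → Bool) → R} {κ : R}
    (hf : braid (.inl j) (.inr (.inl c))
        (crossWeight (w.row j) (rowWeights w (.inr (.inl c) : M.Row n)))
      (braid (.inr (.inl c)) (.inr (.inr j)) (crossWeight (w.row j) (w.row j).bar)
        (braid (.inl j) (.inr (.inl c))
          (crossWeight (rowWeights w (.inr (.inl c) : M.Row n)) (w.row j).bar) f')) =
      fun σ => κ * f σ) :
    ((w.row j).a2 ^ 2 + (w.row j).b1 ^ 2) *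
        (w.a0 * (w.row j).a2 + (w.row j).b1 * w.b0) ^ 2 *
        transfer (column l (rowWeights w ∘ swap (.inl j) (.inr (.inr j))) w.cornerR w.cornerL t) q
          f' (fun _ => true) =
      κ * transfer (column l (rowWeights w) w.cornerR w.cornerL t) q f (fun _ => true) := by
  have hcell : ∀ r s : M.Row n, ∀ p < q, cellAt l r p = cellAt l s p ∧
      cellAt l r p ≠ .corner := fun r s p hp => by
    rw [hq p hp, hq p hp]; exact ⟨rfl, by simp⟩
  have hrc := inl_succ_level_central hM hj c
  have hcs := central_succ_level_inr hM hj c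
  have e1 : (Sum.inl j : M.Row n) ≠ .inr (.inl c) := by simp
  have e2 : (Sum.inl j : M.Row n) ≠ .inr (.inr j) := by simp
  have e3 : (Sum.inr (Sum.inl c) : M.Row n) ≠ .inr (.inr j) := by simp
  -- The three crossings exchange rows `1 2`, `2 3`, `1 2`; in total the outer rows are exchanged.
  set ρ₁ := rowWeights w ∘ swap (.inl j : M.Row n) (.inr (.inl c)) with hρ₁
  set ρ₂ := ρ₁ ∘ swap (.inr (.inl c) : M.Row n) (.inr (.inr j)) with hρ₂
  have hρ₃ : ρ₂ ∘ swap (.inl j : M.Row n) (.inr (.inl c)) =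
      rowWeights w ∘ swap (.inl j) (.inr (.inr j)) := by
    have h := swap_mul_swap_mul_swap e3.symm e2.symm
    rw [swap_comm (Sum.inr (Sum.inl c)), swap_comm (Sum.inr (Sum.inr j))] at h
    rw [← h]
    rfl
  have h₃ := transfer_column_swap (l := l) (c := q) (ρ := ρ₂) (fun r => hw.rowWeights _) w.cornerR
    w.cornerL t hrc (hcell _ _) f'
  have h₂ := transfer_column_swap (l := l) (c := q) (ρ := ρ₁) (fun r => hw.rowWeights _) w.cornerR
    w.cornerL t hcs (hcell _ _) (braid (.inl j) (.inr (.inl c))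
          (crossWeight (rowWeights w (.inr (.inl c) : M.Row n)) (w.row j).bar) f')
  have h₁ := transfer_column_swap (l := l) (c := q) (ρ := rowWeights w) (fun r => hw.rowWeights _)
    w.cornerR w.cornerL t hrc (hcell _ _)
    (braid (.inr (.inl c)) (.inr (.inr j)) (crossWeight (w.row j) (w.row j).bar)
      (braid (.inl j) (.inr (.inl c))
          (crossWeight (rowWeights w (.inr (.inl c) : M.Row n)) (w.row j).bar) f'))
  have v1 : ρ₁ (.inr (.inl c)) = w.row j := by
    rw [hρ₁, comp_apply, swap_apply_right]; rfl
  have v2 : ρ₁ (.inr (.inr j)) = (w.row j).bar := by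
    rw [hρ₁, comp_apply, swap_apply_of_ne_of_ne e2.symm e3.symm]; rfl
  have v3 : ρ₁ (.inl j) = rowWeights w (.inr (.inl c)) := by
    rw [hρ₁, comp_apply, swap_apply_left]
  have v4 : ρ₂ (.inl j) = rowWeights w (.inr (.inl c)) := by
    rw [hρ₂, comp_apply, swap_apply_of_ne_of_ne e1 e2, v3]
  have v5 : ρ₂ (.inr (.inl c)) = (w.row j).bar := by
    rw [hρ₂, comp_apply, swap_apply_left, v2]
  rw [hρ₃, v4, v5] at h₃
  rw [← hρ₂, v1, v2, ← h₃] at h₂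
  rw [← hρ₁, ← h₂] at h₁
  have hf' : braid (.inl j) (.inr (.inl c))
        (crossWeight (rowWeights w (.inl j : M.Row n)) (rowWeights w (.inr (.inl c) : M.Row n)))
      (braid (.inr (.inl c)) (.inr (.inr j)) (crossWeight (w.row j) (w.row j).bar)
        (braid (.inl j) (.inr (.inl c))
          (crossWeight (rowWeights w (.inr (.inl c) : M.Row n)) (w.row j).bar) f')) =
      fun σ => κ * f σ := hf
  rw [hf', transfer_smul (T := column _ _ _ _ _) fun p κ f => colOp_smul _ _ _ κ f] at h₁
  refine Eq.trans ?_ h₁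
  simp only [rowWeights, VertexWeights.bar]
  ring

theorem boundary_eq_bend (d u : R) (j : Fin (M.bends n)) :
    boundary (fun _ => d) (fun _ => u) = fun τ : M.Row n → Bool =>
      (otherBends d u {j} τ * centralEnd τ) * bendWeight d u (τ (.inl j)) (τ (.inr (.inr j))) := by
  funext τ
  rw [boundary_eq d u {j} τ, Finset.prod_singleton]

theorem boundary_eq_bend_central (hM : M.central = 1) (c : Fin M.central) (d u : R)
    (j : Fin (M.bends n)) :
    boundary (fun _ => d) (fun _ => u) = fun τ : M.Row n → Bool =>
      otherBends d u {j} τ * (fun a b e => bendWeight d u a e *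
        if b = true ↔ M ≠ BC then 1 else 0)
          (τ (.inl j)) (τ (.inr (.inl c))) (τ (.inr (.inr j))) := by
  have : Subsingleton (Fin M.central) := by rw [hM]; infer_instance
  funext τ
  rw [boundary_eq d u {j} τ, Finset.prod_singleton, centralEnd, Fintype.prod_subsingleton _ c]
  ring

theorem cellAt_of_not_hasHalfColumn (hM : M.hasHalfColumn = false) (l p : ℕ) (r : M.Row n) :
    cellAt l r p = .vertex := if_neg (by simp [hM])

theorem cellAt_of_lt {l q p : ℕ} (hq : M.cols l = q + 1) (hp : p < q) (r : M.Row n) :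
    cellAt l r p = .vertex := if_neg fun h => by omega

theorem cellAt_last {l q : ℕ} (hM : M.hasHalfColumn = true) (hq : M.cols l = q + 1) (r : M.Row n) :
    cellAt l r q = halfCell r := if_pos ⟨hM, hq.symm⟩

theorem inl_ne_inr_inr (i j : Fin (M.bends n)) : (Sum.inl i : M.Row n) ≠ .inr (.inr j) := by simp

/-- The innermost bend absorbs the crossing of its two rows. -/
theorem flip_relation_B [NeZero n] (lam : Fin n → ℕ) {w : Weights (B.bends n) R}
    (hw : w.IsNormal) {i : R} (hi : i * i = -1) (hD : w.D = fun _ => i) (hU : w.U = fun _ => 1)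
    {j : Fin (B.bends n)} (hj : (j : ℕ) + 1 = B.bends n) :
    ((w.row j).a2 ^ 2 + (w.row j).b1 ^ 2) *
        B.partitionFunction lam { w with row := update w.row j (w.row j).bar } =
      ((w.row j).a2 - i * (w.row j).b1) * ((w.row j).a1 + i * (w.row j).b2) *
        B.partitionFunction lam w := by
  rw [partitionFunction_eq_transfer, partitionFunction_eq_transfer, rowWeights_flip]
  refine transfer_column_flip rfl hw _ hj (fun p _ r => cellAt_of_not_hasHalfColumn rfl _ p r) ?_
  rw [hD, hU, boundary_eq_bend i 1 j, braid_mul_local (inl_ne_inr_inr j j) _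
    ((freeOf_otherBends_inl i 1 (Finset.mem_singleton_self j)).mul (freeOf_centralEnd_inl j))
    ((freeOf_otherBends_inr i 1 (Finset.mem_singleton_self j)).mul (freeOf_centralEnd_inr j))]
  funext σ
  rw [bend_relation_i (hw.1 j) hi]
  ring

/-- In the presence of a half column the innermost bend absorbs the crossing together with the half
column, and the factor depends on the top edge of the latter. -/
theorem flip_relation_half [NeZero n] (hM : M.central = 0) (hM' : M.hasHalfColumn = true)
    (lam : Fin n → ℕ) {q : ℕ} (hq : M.cols (lam 0) = q + 1) {w : Weights (M.bends n) R}
    (hw : w.IsNormal) (hD : w.D = fun _ => 1) (hU : w.U = fun _ => 1)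
    {j : Fin (M.bends n)} (hj : (j : ℕ) + 1 = M.bends n) :
    ((w.row j).a2 ^ 2 + (w.row j).b1 ^ 2) *
        M.partitionFunction lam { w with row := update w.row j (w.row j).bar } =
      (if topEdge lam q = true then (w.row j).a1 ^ 2 + (w.row j).b2 ^ 2
        else (w.row j).a2 ^ 2 + (w.row j).b1 ^ 2) * M.partitionFunction lam w := by
  rw [partitionFunction_eq_transfer, partitionFunction_eq_transfer, rowWeights_flip, hq]
  refine transfer_column_flip hM hw _ hj (fun p hp r => cellAt_of_lt hq hp r) ?_
  simp only [hD, hU]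
  rw [boundary_eq_bend 1 1 j]
  refine braid_colOp_local₂ level_injective (inl_succ_level_inr hM hj) (fun r hr hr' => ?_) _
    ((freeOf_otherBends_inl 1 1 (Finset.mem_singleton_self j)).mul (freeOf_centralEnd_inl j))
    ((freeOf_otherBends_inr 1 1 (Finset.mem_singleton_self j)).mul (freeOf_centralEnd_inr j))
    _ _ _ fun u v a b => ?_
  · rw [comp_apply, swap_apply_of_ne_of_ne hr hr']
  · simp only [comp_apply, swap_apply_left, swap_apply_right, cellAt_last hM' hq]
    exact half_bend_relation (hw.1 j) w.cornerR w.cornerL (topEdge lam q) u v a b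

theorem isNormal_central {w : Weights (M.bends n) R} (hw : w.IsNormal) :
    (⟨w.a0, w.a0, w.b0, w.b0, w.c10, 1⟩ : VertexWeights R).IsNormal := ⟨hw.2.1, rfl⟩

theorem rowWeights_central {w : Weights (M.bends n) R} (hw : w.IsNormal) (c : Fin M.central) :
    rowWeights w (.inr (.inl c) : M.Row n) = ⟨w.a0, w.a0, w.b0, w.b0, w.c10, 1⟩ := by
  rw [← hw.2.2]
  rfl

/-- If there is a central row but no half column, the innermost bend and the right end of the
central row absorb three crossings, as expressed by `hκ`. -/
theorem flip_relation_central [NeZero n] (hM : M.central = 1) (hM' : M.hasHalfColumn = false)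
    (lam : Fin n → ℕ) {w : Weights (M.bends n) R}
    (hw : w.IsNormal) (hD : w.D = fun _ => 1) (hU : w.U = fun _ => 1)
    {j : Fin (M.bends n)} (hj : (j : ℕ) + 1 = M.bends n) {κ : R}
    (hκ : ∀ a b e, braid₃
      (crossWeight (w.row j) ⟨w.a0, w.a0, w.b0, w.b0, w.c10, 1⟩)
      (crossWeight (w.row j) (w.row j).bar)
      (crossWeight ⟨w.a0, w.a0, w.b0, w.b0, w.c10, 1⟩ (w.row j).bar)
      (fun a b e => bendWeight 1 1 a e * if b = true ↔ M ≠ BC then 1 else 0) a b e =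
        κ * (bendWeight 1 1 a e * if b = true ↔ M ≠ BC then 1 else 0)) :
    ((w.row j).a2 ^ 2 + (w.row j).b1 ^ 2) *
        (w.a0 * (w.row j).a2 + (w.row j).b1 * w.b0) ^ 2 *
        M.partitionFunction lam { w with row := update w.row j (w.row j).bar } =
      κ * M.partitionFunction lam w := by
  rw [partitionFunction_eq_transfer, partitionFunction_eq_transfer, rowWeights_flip]
  have c : Fin M.central := ⟨0, by omega⟩
  refine transfer_column_flip_central hM hw _ hj c
    (fun p _ r => cellAt_of_not_hasHalfColumn hM' _ p r) ?_
  rw [hD, hU, boundary_eq_bend_central hM c 1 1 j, rowWeights_central hw,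
    braid_braid_braid_mul_local (by simp) (by simp) (by simp) _ _ _
      (freeOf_otherBends_inl 1 1 (Finset.mem_singleton_self j)) (freeOf_otherBends_central 1 1 _ c)
      (freeOf_otherBends_inr 1 1 (Finset.mem_singleton_self j))
      fun a b e => bendWeight 1 1 a e * if b = true ↔ M ≠ BC then 1 else 0]
  funext σ
  rw [hκ]
  ring

/-- In type `C` the innermost bend absorbs three crossings together with the half column and the
corner. -/
theorem flip_relation_C [NeZero n] (lam : Fin n → ℕ) {w : Weights (C.bends n) R}
    (hw : w.IsNormal) {i : R} (hi : i * i = -1) (hD : w.D = fun _ => i) (hU : w.U = fun _ => 1)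
    (hR : w.cornerR = 1) (hL : w.cornerL = w.a0 - i * w.b0)
    {j : Fin (C.bends n)} (hj : (j : ℕ) + 1 = C.bends n) :
    ((w.row j).a2 ^ 2 + (w.row j).b1 ^ 2) *
        (w.a0 * (w.row j).a2 + (w.row j).b1 * w.b0) ^ 2 *
        C.partitionFunction lam { w with row := update w.row j (w.row j).bar } =
      (w.a0 * (w.row j).a2 + (w.row j).b1 * w.b0) * (w.a0 * (w.row j).a1 + (w.row j).b2 * w.b0) *
        (((w.row j).a2 - i * (w.row j).b1) * ((w.row j).a1 + i * (w.row j).b2)) *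
        C.partitionFunction lam w := by
  rw [partitionFunction_eq_transfer, partitionFunction_eq_transfer, rowWeights_flip]
  have c : Fin C.central := ⟨0, Nat.one_pos⟩
  have hq : C.cols (lam 0) = lam 0 + 1 := rfl
  refine transfer_column_flip_central (q := lam 0) rfl hw _ hj c
    (fun p hp r => cellAt_of_lt hq hp r) ?_
  simp only [hD, hU]
  rw [boundary_eq_bend_central rfl c i 1 j, rowWeights_central hw]
  refine braid_colOp_local₃ level_injective (inl_succ_level_central rfl hj c)
    (central_succ_level_inr rfl hj c) (fun r hr hc hr' => ?_) _
    (freeOf_otherBends_inl i 1 (Finset.mem_singleton_self j)) (freeOf_otherBends_central i 1 _ c)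
    (freeOf_otherBends_inr i 1 (Finset.mem_singleton_self j))
    (fun a b e => bendWeight i 1 a e * if b = true ↔ C ≠ BC then 1 else 0)
    _ _ _ _ fun u v a b e => ?_
  · rw [comp_apply, swap_apply_of_ne_of_ne hr hr']
  · have h3 : Equiv.swap (Sum.inl j) (.inr (.inr j)) (.inr (.inl c) : C.Row n) = .inr (.inl c) :=
      swap_apply_of_ne_of_ne (by simp) (by simp)
    simp only [comp_apply, swap_apply_left, swap_apply_right, h3, cellAt_last rfl hq, hR, hL,
      rowWeights_central hw]
    have h := corner_bend_relation (hw.1 j) rfl (isNormal_central hw) hi (topEdge lam (lam 0))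
      u v a b e
    have hg : (fun a b e => bendWeight i 1 a e * if b = true ↔ C ≠ BC then 1 else 0) =
        fun a b e => bendWeight i 1 a e * if b = true then 1 else 0 := by
      funext a b e
      simp
    rw [hg]
    exact h

/-- Exchange of the innermost spectral index with its inverse, multiplied by auxiliary factors to
make the formula uniform. -/
theorem partitionFunction_flip [NeZero n] (lam : Fin n → ℕ) (hpos : ∀ k, 1 ≤ lam k)
    {w : Weights (M.bends n) R} (hw : w.IsNormal) {i : R} (hi : i * i = -1)
    (hD : w.D = fun _ => M.bendD i) (hU : w.U = fun _ => 1)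
    (hC : M = C → w.cornerR = 1 ∧ w.cornerL = w.a0 - i * w.b0)
    {j : Fin (M.bends n)} (hj : (j : ℕ) + 1 = M.bends n) :
    ((w.row j).a2 ^ 2 + (w.row j).b1 ^ 2) * (w.a0 * (w.row j).a2 + (w.row j).b1 * w.b0) ^ 2 *
        (M.partitionFunction lam { w with row := update w.row j (w.row j).bar } *
          rowFactor M lam i w.a0 w.b0 (w.row j)) =
      ((w.row j).a2 ^ 2 + (w.row j).b1 ^ 2) * (w.a0 * (w.row j).a2 + (w.row j).b1 * w.b0) ^ 2 *
        (M.partitionFunction lam w * rowFactor M lam i w.a0 w.b0 (w.row j).bar) := by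
  have hr := isNormal_central hw
  cases M with
  | B =>
    -- `(a₂ - i b₁) (a₂ + i b₁) = a₂² + b₁²`
    have h := flip_relation_B lam hw hi hD hU hj
    simp only [rowFactor, VertexWeights.bar] at h ⊢
    linear_combination (w.a0 * (w.row j).a2 + (w.row j).b1 * w.b0) ^ 2 *
      ((w.row j).a2 + i * (w.row j).b1) * h - (w.a0 * (w.row j).a2 + (w.row j).b1 * w.b0) ^ 2 *
      B.partitionFunction lam w * ((w.row j).a1 + i * (w.row j).b2) * (w.row j).b1 ^ 2 * hi
  | Bstar =>
    have h := flip_relation_central (M := Bstar) (n := n) rfl rfl lam hw hD hU hj fun a b e => by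
      simpa using bend_relation_outward (hw.1 j) rfl hr a b e
    simp only [rowFactor, VertexWeights.bar] at h ⊢
    linear_combination (w.a0 * (w.row j).a2 + (w.row j).b1 * w.b0) * h
  | C =>
    have h := flip_relation_C lam hw hi hD hU (hC rfl).1 (hC rfl).2 hj
    simp only [rowFactor, VertexWeights.bar] at h ⊢
    linear_combination ((w.row j).a2 + i * (w.row j).b1) *
      (w.a0 * (w.row j).a2 + (w.row j).b1 * w.b0) * h -
      (w.a0 * (w.row j).a2 + (w.row j).b1 * w.b0) ^ 2 * C.partitionFunction lam w *
      ((w.row j).a1 + i * (w.row j).b2) * (w.a0 * (w.row j).a1 + (w.row j).b2 * w.b0) *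
      (w.row j).b1 ^ 2 * hi
  | Cstar =>
    -- The half column has the label `0`, which is not a part.
    have ht : topEdge lam (lam 0) = true := by
      refine decide_eq_true ?_
      rintro ⟨k, hk⟩
      have := hpos k
      omega
    have h := flip_relation_half (M := Cstar) (n := n) rfl rfl lam rfl hw hD hU hj
    rw [if_pos ht] at h
    simp only [rowFactor, VertexWeights.bar] at h ⊢
    linear_combination (w.a0 * (w.row j).a2 + (w.row j).b1 * w.b0) ^ 2 *
      ((w.row j).a2 ^ 2 + (w.row j).b1 ^ 2) * h
  | D =>
    have h0 := hpos 0
    -- The half column has the label `1` and the position `lam 0 - 1`.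
    have hq : D.cols (lam 0) = (lam 0 - 1) + 1 := (Nat.sub_add_cancel h0).symm
    have h := flip_relation_half (M := D) (n := n) rfl rfl lam hq hw hD hU hj
    have ht : topEdge lam (lam 0 - 1) = true ↔ ¬∃ k, lam k = 1 := by
      rw [topEdge, decide_eq_true_iff, Nat.sub_sub_self h0]
    simp only [rowFactor, VertexWeights.bar] at h ⊢
    by_cases h1 : ∃ k, lam k = 1
    · rw [if_neg (fun h => ht.1 h h1)] at h
      rw [if_pos h1, if_pos h1]
      linear_combination (w.a0 * (w.row j).a2 + (w.row j).b1 * w.b0) ^ 2 * h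
    · rw [if_pos (ht.2 h1)] at h
      rw [if_neg h1, if_neg h1]
      linear_combination (w.a0 * (w.row j).a2 + (w.row j).b1 * w.b0) ^ 2 *
        ((w.row j).a2 ^ 2 + (w.row j).b1 ^ 2) * h
  | BC =>
    have h := flip_relation_central (M := BC) (n := n) rfl rfl lam hw hD hU hj fun a b e => by
      simpa using bend_relation_inward (hw.1 j) rfl hr a b e
    simp only [rowFactor, VertexWeights.bar] at h ⊢
    linear_combination (w.a0 * (w.row j).a2 + (w.row j).b1 * w.b0) *
      ((w.row j).a2 ^ 2 + (w.row j).b1 ^ 2) * h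

end Flip

end IceModel

namespace IceModel

open Function MvPolynomial

/-! ### The deformed Weyl denominator -/

section Denominator

variable {R : Type*} [CommRing R] {M : IceModel} {n : ℕ}

/-- The deformed Weyl denominator lies in every submonoid that contains the elementary factors. -/
theorem denominator_mem {m : ℕ} (P : Submonoid R) (lam : Fin n → ℕ) {i : R} (hi : i * i = -1)
    (w : Weights m R) (h1 : ∀ j, (w.row j).a2 + i * (w.row j).b1 ∈ P)
    (h2 : ∀ j, (w.row j).a2 - i * (w.row j).b1 ∈ P)
    (h3 : ∀ j, w.a0 * (w.row j).a2 + (w.row j).b1 * w.b0 ∈ P)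
    (h4 : ∀ j k, j < k → (w.row k).a1 * (w.row j).a2 + (w.row j).b1 * (w.row k).b2 ∈ P)
    (h5 : ∀ j k, j < k → (w.row j).a2 * (w.row k).a2 + (w.row k).b1 * (w.row j).b1 ∈ P) :
    M.denominator lam i w ∈ P := by
  have h6 : ∀ j, (w.row j).a2 ^ 2 + (w.row j).b1 ^ 2 ∈ P := fun j => by
    convert P.mul_mem (h1 j) (h2 j) using 1
    linear_combination (w.row j).b1 ^ 2 * hi
  rw [denominator_eq]
  refine P.mul_mem (P.prod_mem fun j _ => ?_) (P.prod_mem fun j _ => P.prod_mem fun k hk =>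
    P.mul_mem (h4 j k (Finset.mem_Ioi.1 hk)) (h5 j k (Finset.mem_Ioi.1 hk)))
  cases M with
  | B => exact h1 j
  | Bstar => exact h3 j
  | C => exact P.mul_mem (h1 j) (h3 j)
  | Cstar => exact h6 j
  | D =>
    rw [rowFactor]
    split_ifs
    · exact P.one_mem
    · exact h6 j
  | BC => exact P.mul_mem (h3 j) (h6 j)

/-- A product over pairs `a < b` and its transform under the exchange of two neighbouring indices
differ by the factor of the exchanged pair only. -/
theorem exists_prod_pairs_eq {m : ℕ} (h : Fin m → Fin m → R) {j k : Fin m} (hjk : (k : ℕ) = j + 1) :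
    ∃ G, ∏ a, ∏ b ∈ Finset.Ioi a, h a b = h j k * G ∧
      ∏ a, ∏ b ∈ Finset.Ioi a, h (Equiv.swap j k a) (Equiv.swap j k b) = h k j * G := by
  let T : Finset (Fin m × Fin m) := Finset.univ.filter fun p => p.1 < p.2
  have hT : ∀ f : Fin m → Fin m → R, ∏ a, ∏ b ∈ Finset.Ioi a, f a b = ∏ p ∈ T, f p.1 p.2 := by
    intro f
    simp only [T, Finset.prod_filter, Fintype.prod_prod_type, ← Finset.filter_lt_eq_Ioi]
  have hmem : (j, k) ∈ T := by
    simp only [T, Finset.mem_filter, Finset.mem_univ, true_and, Fin.lt_def]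
    omega
  refine ⟨∏ p ∈ T.erase (j, k), h p.1 p.2, ?_, ?_⟩
  · rw [hT, ← Finset.mul_prod_erase T _ hmem]
  · rw [hT, ← Finset.mul_prod_erase T _ hmem, Equiv.swap_apply_left, Equiv.swap_apply_right]
    congr 1
    have hmaps : ∀ p ∈ T.erase (j, k),
        (Equiv.swap j k p.1, Equiv.swap j k p.2) ∈ T.erase (j, k) := by
      rintro ⟨a, b⟩ hp
      simp only [T, Finset.mem_erase, Finset.mem_filter, Finset.mem_univ, true_and, ne_eq,
        Prod.mk.injEq, Fin.lt_def, Fin.ext_iff] at hp ⊢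
      simp only [Equiv.swap_apply_def, Fin.ext_iff]
      split_ifs <;> omega
    refine Finset.prod_nbij' (fun p => (Equiv.swap j k p.1, Equiv.swap j k p.2))
      (fun p => (Equiv.swap j k p.1, Equiv.swap j k p.2)) hmaps hmaps ?_ ?_ ?_
    · simp
    · simp
    · simp

theorem pairFactor_bar (x y : VertexWeights R) : pairFactor x y.bar = pairFactor x y := by
  simp only [pairFactor, VertexWeights.bar]
  ring

end Denominator

/-! ### Irreducible binomials -/

section Irreducible

variable {σ A : Type*} [CommRing A] [IsDomain A]

theorem irreducible_X_mul_X_add_X_mul_X {u v s t : σ} (huv : u ≠ v) (hus : u ≠ s) (hut : u ≠ t)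
    (hvs : v ≠ s) (hvt : v ≠ t) : Irreducible (X u * X v + X s * X t : MvPolynomial σ A) := by
  classical
  refine irreducible_mul_X_add (X u) (X s * X t) v (X_ne_zero u) ?_ ?_ ?_
  · simpa using huv.symm
  · intro h
    have := vars_mul _ _ h
    simp [hvs, hvt] at this
  · rw [(X_prime (i := u) (R := A)).irreducible.isRelPrime_iff_not_dvd]
    intro h
    rcases (X_prime (i := u) (R := A)).dvd_or_dvd h with h | h
    · exact hus (by simpa using h)
    · exact hut (by simpa using h)

theorem irreducible_X_add_C_mul_X {u v : σ} (huv : u ≠ v) (c : A) :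
    Irreducible (X u + MvPolynomial.C c * X v : MvPolynomial σ A) := by
  classical
  rw [← one_mul (X u)]
  refine irreducible_mul_X_add 1 (MvPolynomial.C c * X v) u one_ne_zero (by simp) ?_
    isRelPrime_one_left
  intro h
  have := vars_mul _ _ h
  simp [huv] at this

end Irreducible

/-! ### The hyperoctahedral group acting on the generic weights -/

section Generic

variable {M : IceModel} {n : ℕ}

theorem C_gaussI_mul_self {σ : Type*} :
    (MvPolynomial.C gaussI * MvPolynomial.C gaussI : MvPolynomial σ GaussianInt) = -1 := by
  rw [← map_mul, show gaussI * gaussI = -1 from rfl, map_neg, map_one]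

theorem isNormal_genericWeights (m : ℕ) : (M.genericWeights m).IsNormal :=
  ⟨fun _ => ⟨rfl, rfl⟩, by simp only [genericWeights]; ring, rfl⟩

theorem map_bendD {R S : Type*} [CommRing R] [CommRing S] (f : R →+* S) (i : R) :
    f (M.bendD i) = M.bendD (f i) := by
  cases M <;> simp [bendD]

/-- The replacement of all spectral indices in `t` by their inverses. -/
def Var.flipSet {m : ℕ} (t : Finset (Fin m)) : Var m → Var m
  | a1 k => if k ∈ t then a2 k else a1 k
  | a2 k => if k ∈ t then a1 k else a2 k
  | b1 k => if k ∈ t then b2 k else b1 k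
  | b2 k => if k ∈ t then b1 k else b2 k
  | a0 => a0
  | b0 => b0

theorem map_permute_genericWeights {m : ℕ} (σ : Equiv.Perm (Fin m)) :
    (M.genericWeights m).map (rename (R := GaussianInt) (Var.permute σ)).toRingHom =
      { M.genericWeights m with row := (M.genericWeights m).row ∘ σ } := by
  simp [Weights.map, genericWeights, Var.permute, map_bendD, comp_def]

theorem map_flip_genericWeights {m : ℕ} (j : Fin m) :
    (M.genericWeights m).map (rename (R := GaussianInt) (Var.flip j)).toRingHom =
      { M.genericWeights m with
        row := update (M.genericWeights m).row j ((M.genericWeights m).row j).bar } := by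
  simp [Weights.map, genericWeights, Var.flip, map_bendD]
  funext k
  by_cases h : k = j
  · subst h
    simp [VertexWeights.bar, mul_comm]
  · simp [h]

/-- The polynomials `Z` and `F` transform in the same way under the substitution `φ`. -/
def Proportional {τ : Type*} (Z F : MvPolynomial τ GaussianInt) (φ : τ → τ) : Prop :=
  rename φ Z * F = Z * rename φ F

/-- Since `F` is not zero, the substitutions under which `Z / F` is invariant are closed under
composition. -/
theorem Proportional.comp {τ : Type*} {Z F : MvPolynomial τ GaussianInt} (hF : F ≠ 0)
    {φ ψ : τ → τ} (hφ : Injective φ) (h₁ : Proportional Z F φ) (h₂ : Proportional Z F ψ) :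
    Proportional Z F (φ ∘ ψ) := by
  have h₃ := congrArg (rename φ) h₂
  simp only [map_mul, rename_rename] at h₃
  have hne : rename φ F ≠ 0 := by
    rwa [Ne, ← map_zero (rename φ), (rename_injective φ hφ).eq_iff]
  unfold Proportional at *
  refine mul_right_cancel₀ hne ?_
  linear_combination F * h₃ + rename (φ ∘ ψ) F * h₁

theorem Proportional.id {τ : Type*} (Z F : MvPolynomial τ GaussianInt) :
    Proportional Z F _root_.id := by
  simp [Proportional]

theorem Var.permute_mul {m : ℕ} (σ τ : Equiv.Perm (Fin m)) :
    Var.permute (σ * τ) = Var.permute σ ∘ Var.permute τ := by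
  funext x
  cases x <;> rfl

theorem Var.permute_injective {m : ℕ} (σ : Equiv.Perm (Fin m)) : Injective (Var.permute σ) := by
  intro x y h
  cases x <;> cases y <;> simp_all [Var.permute]

theorem Var.flip_flip {m : ℕ} (j : Fin m) (x : Var m) : Var.flip j (Var.flip j x) = x := by
  cases x <;> simp only [Var.flip] <;> split_ifs with h <;> simp [h]

theorem Var.flip_injective {m : ℕ} (j : Fin m) : Injective (Var.flip j) :=
  (show Involutive (Var.flip j) from Var.flip_flip j).injective

/-- All inversions of a single spectral index are conjugate under permutations. -/
theorem Var.flip_eq_conj {m : ℕ} (j k : Fin m) :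
    Var.flip j = Var.permute (Equiv.swap j k) ∘ Var.flip k ∘ Var.permute (Equiv.swap j k) := by
  have h : ∀ a, Equiv.swap j k a = k ↔ a = j := fun a => by
    rw [← Equiv.eq_symm_apply, Equiv.symm_swap, Equiv.swap_apply_right]
  funext x
  cases x <;> simp only [Var.flip, Var.permute, comp_apply, h] <;> split_ifs <;> simp

theorem Var.flipSet_insert {m : ℕ} {j : Fin m} {t : Finset (Fin m)} (hj : j ∉ t) :
    Var.flipSet (insert j t) = Var.flip j ∘ Var.flipSet t := by
  have h : ∀ a, a ∈ t → a ≠ j := fun a ha h => hj (h ▸ ha)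
  funext x
  rcases x with a | a | a | a | _ | _
  on_goal 5 => rfl
  on_goal 5 => rfl
  all_goals
    have ha := h a
    simp only [Var.flip, Var.flipSet, comp_apply, Finset.mem_insert]
    split_ifs <;> simp_all

theorem Var.flipSet_empty {m : ℕ} : Var.flipSet (∅ : Finset (Fin m)) = _root_.id := by
  funext x
  cases x <;> simp [Var.flipSet]

/-- The symmetric group is generated by the exchanges of neighbouring elements. -/
theorem perm_induction {m : ℕ} {p : Equiv.Perm (Fin m) → Prop} (h1 : p 1)
    (hmul : ∀ σ τ, p σ → p τ → p (σ * τ))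
    (hswap : ∀ j k : Fin m, (k : ℕ) = j + 1 → p (Equiv.swap j k)) (σ : Equiv.Perm (Fin m)) :
    p σ := by
  cases m with
  | zero => rwa [Subsingleton.elim σ 1]
  | succ m =>
    have hσ : σ ∈ Submonoid.closure
        (Set.range fun i : Fin m ↦ Equiv.swap i.castSucc i.succ) := by
      rw [Equiv.Perm.mclosure_swap_castSucc_succ]
      trivial
    induction hσ using Submonoid.closure_induction with
    | mem x hx =>
      obtain ⟨i, rfl⟩ := hx
      exact hswap _ _ rfl
    | one => exact h1
    | mul x y _ _ hx hy => exact hmul x y hx hy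

/-- The value of the generic denominator at a point. -/
theorem eval_denominator {m : ℕ} (lam : Fin n → ℕ) (v : Var m → GaussianInt) :
    MvPolynomial.eval v (M.denominator lam (MvPolynomial.C gaussI) (M.genericWeights m)) =
      M.denominator lam gaussI ((M.genericWeights m).map (MvPolynomial.eval v)) := by
  rw [map_denominator, eval_C]

/-- The point at which all weights of types `a` are `1` and all weights of types `b` are `0`. -/
def unitPoint {m : ℕ} : Var m → GaussianInt
  | .a1 _ => 1
  | .a2 _ => 1
  | .a0 => 1
  | _ => 0

theorem denominator_genericWeights_ne_zero {m : ℕ} (lam : Fin n → ℕ) :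
    M.denominator lam (MvPolynomial.C gaussI) (M.genericWeights m) ≠ 0 := by
  intro h
  have h' := congrArg (MvPolynomial.eval unitPoint) h
  rw [eval_denominator, map_zero] at h'
  refine nonZeroDivisors.ne_zero (denominator_mem (nonZeroDivisors GaussianInt) lam (i := gaussI)
    rfl _ ?_ ?_ ?_ ?_ ?_) h' <;> intros <;> simp [Weights.map, genericWeights, unitPoint]

variable [NeZero n]

theorem proportional_swap (lam : Fin n → ℕ) {j k : Fin (M.bends n)} (hjk : (k : ℕ) = j + 1) :
    Proportional (M.partitionFunction lam (M.genericWeights (M.bends n)))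
      (M.denominator lam (MvPolynomial.C gaussI) (M.genericWeights (M.bends n)))
      (Var.permute (Equiv.swap j k)) := by
  set w := M.genericWeights (M.bends n) with hw
  have hZ := partitionFunction_swap lam (isNormal_genericWeights (M.bends n))
    (d := M.bendD (MvPolynomial.C gaussI)) (u := 1) rfl rfl hjk
  have h1 := map_partitionFunction
    (rename (R := GaussianInt) (Var.permute (Equiv.swap j k))).toRingHom lam w
  have h2 := map_denominator (M := M)
    (rename (R := GaussianInt) (Var.permute (Equiv.swap j k))).toRingHom lam
    (MvPolynomial.C gaussI) w
  rw [hw, map_permute_genericWeights, ← hw] at h1 h2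
  rw [← hw] at hZ
  simp only [AlgHom.toRingHom_eq_coe, RingHom.coe_coe, algHom_C, algebraMap_eq] at h1 h2
  rw [Proportional, h1, h2, denominator_eq, denominator_eq]
  obtain ⟨G, hG, hG'⟩ := exists_prod_pairs_eq (fun a b => pairFactor (w.row a) (w.row b)) hjk
  simp only [comp_apply]
  rw [hG, hG', Equiv.prod_comp (Equiv.swap j k) fun a =>
    rowFactor M lam (MvPolynomial.C gaussI) w.a0 w.b0 (w.row a)]
  have hp : (w.row k).a1 * (w.row j).a2 + (w.row j).b1 * (w.row k).b2 ≠ 0 := by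
    intro h
    have h' := congrArg (MvPolynomial.eval unitPoint) h
    simp [hw, genericWeights, unitPoint] at h'
  have hZ' := mul_left_cancel₀ hp
    (b := ((w.row k).a1 * (w.row j).a2 + (w.row j).b1 * (w.row k).b2) *
    M.partitionFunction lam { w with row := w.row ∘ Equiv.swap j k }) (c :=
    ((w.row j).a1 * (w.row k).a2 + (w.row k).b1 * (w.row j).b2) * M.partitionFunction lam w)
    (by linear_combination hZ)
  simp only [pairFactor]
  linear_combination (∏ a, rowFactor M lam (MvPolynomial.C gaussI) w.a0 w.b0 (w.row a)) *
    ((w.row j).a2 * (w.row k).a2 + (w.row k).b1 * (w.row j).b1) * G * hZ'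

theorem proportional_flip_last (lam : Fin n → ℕ) (hpos : ∀ k, 1 ≤ lam k) {j : Fin (M.bends n)}
    (hj : (j : ℕ) + 1 = M.bends n) :
    Proportional (M.partitionFunction lam (M.genericWeights (M.bends n)))
      (M.denominator lam (MvPolynomial.C gaussI) (M.genericWeights (M.bends n)))
      (Var.flip j) := by
  set w := M.genericWeights (M.bends n) with hw
  have hZ := partitionFunction_flip (M := M) lam hpos (isNormal_genericWeights (M.bends n))
    C_gaussI_mul_self rfl rfl (fun _ => ⟨rfl, rfl⟩) hj
  have h1 := map_partitionFunction (rename (R := GaussianInt) (Var.flip j)).toRingHom lam w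
  have h2 := map_denominator (M := M) (rename (R := GaussianInt) (Var.flip j)).toRingHom lam
    (MvPolynomial.C gaussI) w
  rw [hw, map_flip_genericWeights, ← hw] at h1 h2
  rw [← hw] at hZ
  simp only [AlgHom.toRingHom_eq_coe, RingHom.coe_coe, algHom_C, algebraMap_eq] at h1 h2
  rw [Proportional, h1, h2, denominator_eq, denominator_eq]
  have hA : ((w.row j).a2 ^ 2 + (w.row j).b1 ^ 2) *
      (w.a0 * (w.row j).a2 + (w.row j).b1 * w.b0) ^ 2 ≠ 0 := by
    intro h
    have h' := congrArg (MvPolynomial.eval unitPoint) h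
    simp [hw, genericWeights, unitPoint] at h'
  have hZ' := mul_left_cancel₀ hA hZ
  have hpairs : ∏ a, ∏ b ∈ Finset.Ioi a, pairFactor (update w.row j (w.row j).bar a)
      (update w.row j (w.row j).bar b) =
        ∏ a, ∏ b ∈ Finset.Ioi a, pairFactor (w.row a) (w.row b) := by
    refine Finset.prod_congr rfl fun a _ => Finset.prod_congr rfl fun b hb => ?_
    have hab := Finset.mem_Ioi.1 hb
    -- The innermost index `j` is the greatest one, so that it occurs as the second of a pair only.
    have ha : a ≠ j := by
      rintro rfl
      have := b.isLt
      have := Fin.lt_def.1 hab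
      omega
    rw [update_of_ne ha]
    by_cases hbj : b = j
    · rw [hbj, update_self, pairFactor_bar]
    · rw [update_of_ne hbj]
  have hrow : ∏ a, rowFactor M lam (MvPolynomial.C gaussI) w.a0 w.b0
      (update w.row j (w.row j).bar a) =
      rowFactor M lam (MvPolynomial.C gaussI) w.a0 w.b0 (w.row j).bar *
        ∏ a ∈ Finset.univ.erase j, rowFactor M lam (MvPolynomial.C gaussI) w.a0 w.b0 (w.row a) := by
    rw [← Finset.mul_prod_erase Finset.univ _ (Finset.mem_univ j), update_self]
    congr 1
    exact Finset.prod_congr rfl fun a ha => by rw [update_of_ne (Finset.ne_of_mem_erase ha)]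
  simp only
  rw [hpairs, hrow, ← Finset.mul_prod_erase Finset.univ _ (Finset.mem_univ j)]
  linear_combination (∏ a ∈ Finset.univ.erase j,
    rowFactor M lam (MvPolynomial.C gaussI) w.a0 w.b0 (w.row a)) *
    (∏ a, ∏ b ∈ Finset.Ioi a, pairFactor (w.row a) (w.row b)) * hZ'

/-- The generic quotient is invariant under all permutations of the spectral indices, because these
are generated by the exchanges of neighbours. -/
theorem proportional_permute (lam : Fin n → ℕ) (σ : Equiv.Perm (Fin (M.bends n))) :
    Proportional (M.partitionFunction lam (M.genericWeights (M.bends n)))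
      (M.denominator lam (MvPolynomial.C gaussI) (M.genericWeights (M.bends n)))
      (Var.permute σ) := by
  refine perm_induction (p := fun σ => Proportional
    (M.partitionFunction lam (M.genericWeights (M.bends n)))
    (M.denominator lam (MvPolynomial.C gaussI) (M.genericWeights (M.bends n)))
    (Var.permute σ)) ?_ (fun σ τ hσ hτ => ?_) (fun j k hjk => proportional_swap lam hjk) σ
  · convert Proportional.id _ _ using 1
    funext x
    cases x <;> rfl
  · rw [Var.permute_mul]
    exact hσ.comp (denominator_genericWeights_ne_zero lam) (Var.permute_injective σ) hτ

/-- The generic quotient is invariant under the inversion of any spectral index, by conjugation with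
the case of the innermost one. -/
theorem proportional_flip (lam : Fin n → ℕ) (hpos : ∀ k, 1 ≤ lam k) (j : Fin (M.bends n)) :
    Proportional (M.partitionFunction lam (M.genericWeights (M.bends n)))
      (M.denominator lam (MvPolynomial.C gaussI) (M.genericWeights (M.bends n)))
      (Var.flip j) := by
  have hj := j.isLt
  have hF := denominator_genericWeights_ne_zero (M := M) (m := M.bends n) lam
  rw [Var.flip_eq_conj j ⟨M.bends n - 1, by omega⟩]
  exact (proportional_permute lam _).comp hF (Var.permute_injective _)
    ((proportional_flip_last lam hpos (Nat.sub_add_cancel (by omega))).comp hF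
      (Var.flip_injective _) (proportional_permute lam _))

theorem proportional_flipSet (lam : Fin n → ℕ) (hpos : ∀ k, 1 ≤ lam k)
    (t : Finset (Fin (M.bends n))) :
    Proportional (M.partitionFunction lam (M.genericWeights (M.bends n)))
      (M.denominator lam (MvPolynomial.C gaussI) (M.genericWeights (M.bends n)))
      (Var.flipSet t) := by
  induction t using Finset.induction_on with
  | empty =>
    rw [Var.flipSet_empty]
    exact Proportional.id _ _
  | insert j t hj ih =>
    rw [Var.flipSet_insert hj]
    exact (proportional_flip lam hpos j).comp (denominator_genericWeights_ne_zero lam)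
      (Var.flip_injective j) ih

end Generic

/-! ### Divisibility by the denominator -/

section Divisibility

variable {M : IceModel} {n : ℕ}

/-- An irreducible polynomial is coprime to the denominator with all spectral indices inverted if it
vanishes at a point where none of the elementary factors of the latter does. -/
theorem isRelPrime_of_eval {m : ℕ} (lam : Fin n → ℕ) {f : MvPolynomial (Var m) GaussianInt}
    (hf : Irreducible f) (v : Var m → GaussianInt) (hv : MvPolynomial.eval v f = 0)
    (h1 : ∀ j, v (.a1 j) + gaussI * v (.b2 j) ≠ 0) (h2 : ∀ j, v (.a1 j) - gaussI * v (.b2 j) ≠ 0)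
    (h3 : ∀ j, v .a0 * v (.a1 j) + v (.b2 j) * v .b0 ≠ 0)
    (h4 : ∀ j k, j < k → v (.a2 k) * v (.a1 j) + v (.b2 j) * v (.b1 k) ≠ 0)
    (h5 : ∀ j k, j < k → v (.a1 j) * v (.a1 k) + v (.b2 k) * v (.b2 j) ≠ 0) :
    IsRelPrime f (rename (Var.flipSet Finset.univ)
      (M.denominator lam (MvPolynomial.C gaussI) (M.genericWeights m))) := by
  rw [hf.isRelPrime_iff_not_dvd]
  rintro ⟨g, hg⟩
  have h := congrArg (MvPolynomial.eval v) hg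
  rw [map_mul, hv, zero_mul, eval_rename, eval_denominator] at h
  refine nonZeroDivisors.ne_zero (denominator_mem (nonZeroDivisors GaussianInt) lam (i := gaussI)
    rfl _ ?_ ?_ ?_ ?_ ?_) h <;>
    simpa [Weights.map, genericWeights, Var.flipSet]

/-- The denominator is coprime to its transform under the inversion of all spectral indices. -/
theorem isRelPrime_denominator {m : ℕ} (lam : Fin n → ℕ) :
    IsRelPrime (M.denominator lam (MvPolynomial.C gaussI) (M.genericWeights m))
      (rename (Var.flipSet Finset.univ)
        (M.denominator lam (MvPolynomial.C gaussI) (M.genericWeights m))) := by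
  set G := rename (Var.flipSet Finset.univ)
        (M.denominator lam (MvPolynomial.C gaussI) (M.genericWeights m)) with hG
  -- The polynomials that are coprime to `G` form a submonoid.
  let P : Submonoid (MvPolynomial (Var m) GaussianInt) :=
    { carrier := {f | IsRelPrime f G}
      one_mem' := isRelPrime_one_left
      mul_mem' := fun ha hb => IsRelPrime.mul_left ha hb }
  have hlin : ∀ (j : Fin m) (c : GaussianInt), (c = gaussI ∨ c = -gaussI) →
      IsRelPrime (X (.a2 j) + MvPolynomial.C c * X (.b1 j)) G := by
    intro j c hc
    refine isRelPrime_of_eval lam (irreducible_X_add_C_mul_X (by simp) c)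
      (fun x => match x with
        | .a2 k => if k = j then -c else 1
        | _ => 1) (by simp) ?_ ?_ ?_ ?_ ?_ <;>
      intros <;> dsimp only <;>
      rcases hc with rfl | rfl <;> (try split_ifs) <;> decide
  -- Each elementary factor is irreducible, and a point is given at which it vanishes, whereas the
  -- elementary factors of the transformed denominator do not.
  refine denominator_mem P lam C_gaussI_mul_self _ (fun j => ?_) (fun j => ?_) (fun j => ?_)
    (fun j k hjk => ?_) (fun j k hjk => ?_)
  · exact hlin j gaussI (.inl rfl)
  · have h := hlin j (-gaussI) (.inr rfl)
    rwa [map_neg, neg_mul, ← sub_eq_add_neg] at h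
  · refine isRelPrime_of_eval lam (irreducible_X_mul_X_add_X_mul_X (by simp) (by simp) (by simp)
      (by simp) (by simp))
      (fun x => match x with
        | .a2 k => if k = j then -2 else 1
        | .b0 => 2
        | _ => 1) (by simp [genericWeights]) ?_ ?_ ?_ ?_ ?_ <;>
      intros <;> dsimp only <;> (try split_ifs) <;> decide
  · refine isRelPrime_of_eval lam (irreducible_X_mul_X_add_X_mul_X (by simp) (by simp) (by simp)
      (by simp) (by simp))
      (fun x => match x with
        | .a2 l => if l = j then -2 else 1
        | .b2 l => if l = k then 2 else 1
        | _ => 1) (by simp [genericWeights]) ?_ ?_ ?_ ?_ ?_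
    on_goal 4 =>
      intro a b hab
      dsimp only
      -- The factor of the pair `a < b` vanishes here only if `a = k` and `b = j`, but `j < k`.
      have : ¬(b = j ∧ a = k) := fun h => absurd hjk (by rw [← h.1, ← h.2]; exact hab.not_gt)
      split_ifs with h1 h2 h2
      · exact absurd ⟨h1, h2⟩ this
      all_goals decide
    all_goals
      intros
      dsimp only
      (try split_ifs) <;> decide
  · have hne := hjk.ne
    refine isRelPrime_of_eval lam (irreducible_X_mul_X_add_X_mul_X (by simpa using hne) (by simp)
      (by simp) (by simp) (by simp))
      (fun x => match x with
        | .a2 l => if l = j then 2 else if l = k then -1 else 1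
        | .b1 l => if l = k then 2 else 1
        | _ => 1) (by simp [genericWeights, hne, hne.symm]) ?_ ?_ ?_ ?_ ?_ <;>
      intros <;> dsimp only <;>
      (try split_ifs) <;> decide

/-- The generic weights specialize to arbitrary weights with `c₂ = 1`. -/
theorem map_eval₂_genericWeights {R : Type*} [CommRing R] {m : ℕ} (f : GaussianInt →+* R)
    {w : Weights m R} (hff : FreeFermionic w) (hD : ∀ j, w.D j = M.bendD (f gaussI) ∧ w.U j = 1) :
    (M.genericWeights m).map (eval₂Hom f w.assign) =
      { w.normalize with cornerR := 1, cornerL := w.a0 - f gaussI * w.b0 } := by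
  have hc : ∀ j, (w.row j).c1 * (w.row j).c2 =
    (w.row j).a1 * (w.row j).a2 + (w.row j).b1 * (w.row j).b2 := fun j => (hff.1 j).symm
  have hD' : w.D = fun _ => M.bendD (f gaussI) := funext fun j => (hD j).1
  have hU' : w.U = fun _ => 1 := funext fun j => (hD j).2
  simp [Weights.map, genericWeights, Weights.normalize, Weights.assign, map_bendD, hc, hff.2, hD',
    hU']

end Divisibility

end IceModel

theorem mainTheorem1 (M : IceModel) {n : ℕ} [NeZero n] (lam : Fin n → ℕ)
    (hlam : StrictAnti lam) (hpos : ∀ k, 1 ≤ lam k) :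
    ∃ Q : MvPolynomial (IceModel.Var (M.bends n)) GaussianInt,
      -- the denominator divides the partition function for generic weights with `c₂ = 1`
      M.partitionFunction lam (M.genericWeights (M.bends n)) =
        M.denominator lam (MvPolynomial.C IceModel.gaussI) (M.genericWeights (M.bends n)) * Q ∧
      -- the quotient is invariant under the spectral symmetries
      (∀ σ : Equiv.Perm (Fin (M.bends n)),
        MvPolynomial.rename (IceModel.Var.permute σ) Q = Q) ∧
      (∀ j : Fin (M.bends n), MvPolynomial.rename (IceModel.Var.flip j) Q = Q) ∧
      -- the same polynomial is the quotient for arbitrary free-fermionic weights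
      (∀ (R : Type*) [CommRing R] (f : GaussianInt →+* R)
        (w : IceModel.Weights (M.bends n) R),
        IceModel.FreeFermionic w →
        M.ConventionalBends (f IceModel.gaussI) w →
        (M = IceModel.C → w.c20 = 1) →
        M.partitionFunction lam w =
          (∏ j, (w.row j).c2) * (if M = IceModel.BC then w.c20 else 1) *
            (M.denominator lam (f IceModel.gaussI) w * Q.eval₂ f w.assign)) := by
  have hF := IceModel.denominator_genericWeights_ne_zero (M := M) (m := M.bends n) lam
  have hperm := IceModel.proportional_permute (M := M) lam
  have hflip := IceModel.proportional_flip (M := M) lam hpos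
  obtain ⟨Q, hQ⟩ : M.denominator lam (MvPolynomial.C IceModel.gaussI)
      (M.genericWeights (M.bends n)) ∣ M.partitionFunction lam (M.genericWeights (M.bends n)) := by
    -- `F` divides the product of `Z` with its own transform under the inversion of all indices, and
    -- is coprime to the latter.
    refine (IceModel.isRelPrime_denominator lam).dvd_of_dvd_mul_right ?_
    exact ⟨_, (IceModel.proportional_flipSet lam hpos Finset.univ).symm.trans (mul_comm _ _)⟩
  -- a substitution under which `F Q` and `F` transform in the same way fixes `Q`
  have hinv : ∀ φ : IceModel.Var (M.bends n) → IceModel.Var (M.bends n), Function.Injective φ →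
      IceModel.Proportional (M.partitionFunction lam (M.genericWeights (M.bends n)))
        (M.denominator lam (MvPolynomial.C IceModel.gaussI) (M.genericWeights (M.bends n))) φ →
      MvPolynomial.rename φ Q = Q := by
    intro φ hφ h
    rw [IceModel.Proportional, hQ, map_mul] at h
    have hF' : MvPolynomial.rename φ (M.denominator lam (MvPolynomial.C IceModel.gaussI)
        (M.genericWeights (M.bends n))) ≠ 0 := by
      rwa [Ne, ← map_zero (MvPolynomial.rename φ), (MvPolynomial.rename_injective φ hφ).eq_iff]
    exact mul_left_cancel₀ (mul_ne_zero hF' hF) (by linear_combination h)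
  refine ⟨Q, hQ, fun σ => hinv _ (IceModel.Var.permute_injective σ) (hperm σ),
    fun j => hinv _ (IceModel.Var.flip_injective j) (hflip j), ?_⟩
  intro R _ f w hff hconv hC
  have h := congrArg (MvPolynomial.eval₂Hom f w.assign) hQ
  rw [map_mul, IceModel.map_partitionFunction, IceModel.map_denominator,
    IceModel.map_eval₂_genericWeights f hff hconv.1,
    IceModel.partitionFunction_congr_corner lam w.normalize _ _ fun hM =>
      ⟨(hconv.2 hM).1.symm, (hconv.2 hM).2.symm⟩,
    MvPolynomial.coe_eval₂Hom, MvPolynomial.eval₂_C] at h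
  rw [IceModel.partitionFunction_eq_mul_normalize lam w hC, h]
  rfl
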